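/- Let $M$ be a smooth manifold of dimension $m=p+q$, let $g$ be a smooth pseudo-Riemannian metric on $M$ of signature $(p,q)$, let $LM$ be the $\mathrm{GL}(m,\mathbb R)$-bundle of linear frames $u:\mathbb R^m\to T_xM$, and let $\Xi$ be a smooth $\mathrm{GL}(m,\mathbb R)$-invariant vector field on $LM$. Let $U\subseteq M$ be open (for instance $U=M$ when $M$ admits such a reduction, or a small neighbourhood of any given point) and let $P\subseteq LM|_U$ be a reduction of $LM|_U$ to the identity component $\mathrm{SO}(p,q)^e$ consisting of $g$-orthonormal frames. For an $\mathrm{Ad}$-invariant complement $\mathfrak m$ of $\mathfrak{so}(p,q)$ in $\mathfrak{gl}(m,\mathbb R)$ one has $T_uLM=T_uP\oplus\mathcal M_u$ for $u\in P$, where $\mathcal M_u$ consists of the values at $u$ of the fundamental vector fields of elements of $\mathfrak m$; the component $\Xi_{\mathrm K}$ of $\Xi|_P$ along $TP$ is the generalized Kosmann vector field. Its local flow on $P$ extends equivariantly to frames over $U$ and hence acts, by maps $((\Phi_{\mathrm K})_t)_\lambda$, on every bundle associated with $LM$. The (restricted) $\mathrm{SO}(p,q)^e$-reductive Lie derivative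 of a section $\sigma$ of an associated vector bundle is $$\pounds_\Xi^{\mathrm{SO}(p,q)^e}\sigma=\frac{\partial}{\partial t}\Big|_{t=0}\,((\Phi_{\mathrm K})_{-t})_\lambda\circ\sigma\circ\varphi_t ,$$ where $\varphi_t$ is the flow of the projection of $\Xi$ to $M$. Then: 1. The space $\mathrm{Sym}_\eta$ of endomorphisms that are symmetric for the standard metric $\eta$ of signature $(p,q)$ is an $\mathrm{Ad}_{\mathrm{SO}(p,q)^e}$-invariant complement of $\mathfrak{so}(p,q)$ in $\mathfrak{gl}(m,\mathbb R)$; and for every $\mathrm{Ad}_{\mathrm{SO}(p,q)^e}$-invariant complement $\mathfrak m$, in particular $\mathfrak m=\mathrm{Sym}_\eta$, the reductive Lie derivative of $g$, regarded as a section of a bundle associated with $LM$, exists and vanishes identically on $U$: $$\pounds_\Xi^{\mathrm{SO}(p,q)^e}g\equiv0 .$$ 2. Suppose that $\Xi=L\xi$ is the natural lift of a smooth vector field $\xi$ on $M$ with local flow $\varphi_t$, and take $\mathfrak m=\mathrm{Sym}_\eta$. For $x\in U$ and small $t$ let $b_t$ be the $g$-symmetric automorphism of $T_xM$, continuous at $t=0$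 with $b_0=\mathrm{id}$, for which $d\varphi_t\circ b_t:T_xM\to T_{\varphi_t(x)}M$ is an isometry for $g$. For every $u\in P$ the curve $t\mapsto d\varphi_t\circ b_t\circ u$ lies in $P$ for small $t$ and has velocity $(L\xi)_{\mathrm K}(u)$ at $t=0$. Consequently, for every smooth section $\sigma$ of a finite-rank real vector bundle associated with $LM$, one has on $U$ $$\pounds^{\mathrm{SO}(p,q)^e}_{L\xi}\sigma=\pounds^g_\xi\sigma ,$$ where $\pounds^g_\xi\sigma$ is the metric Lie derivative of Bourguignon and Gauduchon (here in any signature), i.e. the derivative at $t=0$ of the pull-back of $\sigma$ by the isometries $d\varphi_t\circ b_t$. -/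

import Mathlib

open Bundle Filter Topology Manifold
open scoped ContDiff

/-! ### Linear algebra on `ℝ^m` -/

/-- The typical fibre `ℝ^m`. -/
abbrev Rm (m : ℕ) : Type := EuclideanSpace ℝ (Fin m)

/-- The Lie algebra `𝔤𝔩(m, ℝ)`. -/
abbrev gl (m : ℕ) : Type := Rm m →L[ℝ] Rm m

/-- The Lie group `GL(m, ℝ)`. -/
abbrev GLm (m : ℕ) : Type := (gl m)ˣ

/-- The standard metric of signature `(p, m - p)` on `ℝ^m`. -/
noncomputable def eta (m p : ℕ) (v w : Rm m) : ℝ :=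
  ∑ i : Fin m, (if (i : ℕ) < p then (1 : ℝ) else -1) * (v i * w i)

/-- The pseudo-orthogonal group `SO(p, q)`, `p + q = m`. -/
noncomputable def SOpq (m p : ℕ) : Subgroup (GLm m) where
  carrier := {a | (∀ v w : Rm m, eta m p ((a : gl m) v) ((a : gl m) w) = eta m p v w) ∧
    LinearMap.det ((a : gl m) : Rm m →ₗ[ℝ] Rm m) = 1}
  one_mem' := by
    refine ⟨fun v w => rfl, ?_⟩
    exact LinearMap.det_id
  mul_mem' := by
    rintro a b ⟨ha, ha'⟩ ⟨hb, hb'⟩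
    refine ⟨fun v w => ?_, ?_⟩
    · simp [ha, hb]
    · have : (((a * b : GLm m) : gl m) : Rm m →ₗ[ℝ] Rm m)
          = ((a : gl m) : Rm m →ₗ[ℝ] Rm m) * ((b : gl m) : Rm m →ₗ[ℝ] Rm m) := rfl
      rw [this, map_mul, ha', hb', one_mul]
  inv_mem' := by
    rintro a ⟨ha, ha'⟩
    have key : ∀ v, (a : gl m) (((a⁻¹ : GLm m) : gl m) v) = v := fun v =>
      congrArg (fun f : gl m => f v) a.mul_inv
    refine ⟨fun v w => ?_, ?_⟩
    · rw [← ha, key, key]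
    · have h1 : ((a : gl m) : Rm m →ₗ[ℝ] Rm m) * (((a⁻¹ : GLm m) : gl m) : Rm m →ₗ[ℝ] Rm m)
          = 1 := by
        ext1 v
        exact key v
      have h2 := congrArg LinearMap.det h1
      rw [map_mul, ha', one_mul, map_one] at h2
      exact h2

/-- `SO(p, q)^e`: the connected component of the identity of `SO(p, q)`, as a subgroup of
`GL(m, ℝ)`. -/
noncomputable def SOe (m p : ℕ) : Subgroup (GLm m) :=
  (Subgroup.connectedComponentOfOne (SOpq m p)).map (SOpq m p).subtype

/-- The Lie algebra of a closed subgroup `G` of `GL(m, ℝ)`: the endomorphisms generating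
one-parameter subgroups of `G`. -/
def lieAlg {m : ℕ} (G : Subgroup (GLm m)) : Set (gl m) :=
  {A | ∀ t : ℝ, ∃ a ∈ G, (a : gl m) = NormedSpace.exp (t • A)}

/-- `𝔪` is an `Ad_G`-invariant complement of `𝔤` in `𝔤𝔩(m, ℝ)`: it exhibits `G` as a reductive Lie
subgroup of `GL(m, ℝ)`. -/
def IsReductiveComplement {m : ℕ} (G : Subgroup (GLm m)) (𝔪 : Submodule ℝ (gl m)) : Prop :=
  (∀ a ∈ G, ∀ B ∈ 𝔪, (a : gl m) * B * ((a⁻¹ : GLm m) : gl m) ∈ 𝔪) ∧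
    ∀ X : gl m, ∃! B : gl m, B ∈ 𝔪 ∧ X - B ∈ lieAlg G

/-- The `η`-symmetric endomorphisms of `ℝ^m`. -/
noncomputable def etaSymm (m p : ℕ) : Submodule ℝ (gl m) where
  carrier := {B | ∀ v w : Rm m, eta m p (B v) w = eta m p v (B w)}
  zero_mem' := by intro v w; simp [eta]
  add_mem' := by
    intro A B hA hB v w
    have h1 := hA v w
    have h2 := hB v w
    simp only [eta] at h1 h2 ⊢
    simp only [_root_.add_apply, PiLp.add_apply, add_mul, mul_add, Finset.sum_add_distrib, h1, h2]
  smul_mem' := by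
    intro c B hB v w
    have h1 := hB v w
    simp only [eta] at h1 ⊢
    have e1 : ∀ i : Fin m, (if (i : ℕ) < p then (1 : ℝ) else -1) * ((c • B) v i * w i)
        = c * ((if (i : ℕ) < p then (1 : ℝ) else -1) * (B v i * w i)) := fun i => by
      simp only [_root_.smul_apply, PiLp.smul_apply, smul_eq_mul]; ring
    have e2 : ∀ i : Fin m, (if (i : ℕ) < p then (1 : ℝ) else -1) * (v i * (c • B) w i)
        = c * ((if (i : ℕ) < p then (1 : ℝ) else -1) * (v i * B w i)) := fun i => by
      simp only [_root_.smul_apply, PiLp.smul_apply, smul_eq_mul]; ring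
    simp only [e1, e2, ← Finset.mul_sum, h1]

/-! ### The bundle of linear frames -/

section Frames

variable {m : ℕ} {M : Type*} [TopologicalSpace M] [ChartedSpace (Rm m) M] [IsManifold (𝓡 m) ∞ M]

/-- The total space of the vector bundle `Hom(ℝ^m, TM)` over `M`, a smooth manifold that contains
the linear frames `u : ℝ^m → T_x M` as an open subset. -/
abbrev HomTM (m : ℕ) (M : Type*) [TopologicalSpace M] [ChartedSpace (Rm m) M]
    [IsManifold (𝓡 m) ∞ M] : Type _ :=
  TotalSpace (Rm m →L[ℝ] Rm m) (fun x : M => Trivial M (Rm m) x →L[ℝ] TangentSpace (𝓡 m) x)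

/-- The model with corners of the manifold `Hom(ℝ^m, TM)`. -/
noncomputable abbrev IHom (m : ℕ) := (𝓡 m).prod 𝓘(ℝ, Rm m →L[ℝ] Rm m)

/-- The linear map `ℝ^m → T_x M` underlying a point of `Hom(ℝ^m, TM)` over `x`. -/
noncomputable def HomTM.hom (u : HomTM m M) : Rm m →L[ℝ] TangentSpace (𝓡 m) u.proj := u.snd

/-- A point of `Hom(ℝ^m, TM)` from a base point and a linear map. -/
noncomputable def HomTM.mk (x : M) (f : Rm m →L[ℝ] TangentSpace (𝓡 m) x) : HomTM m M := ⟨x, f⟩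

/-- The bundle `LM` of linear frames, an open subset of `Hom(ℝ^m, TM)`: a frame at `x` is a linear
isomorphism of `ℝ^m` onto `T_x M`. -/
def LM (m : ℕ) (M : Type*) [TopologicalSpace M] [ChartedSpace (Rm m) M]
    [IsManifold (𝓡 m) ∞ M] : Set (HomTM m M) :=
  {u | Function.Bijective (HomTM.hom u)}

/-- Right multiplication `u ↦ u ∘ A` on `Hom(ℝ^m, TM)`. For invertible `A` it restricts to the right
action of `GL(m, ℝ)` on `LM`. -/
noncomputable def rightMul (A : gl m) (u : HomTM m M) : HomTM m M := HomTM.mk u.proj ((HomTM.hom u).comp A)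

/-- The value at `u` of the fundamental vector field of `A ∈ 𝔤𝔩(m, ℝ)`, that is, the velocity at
`t = 0` of `t ↦ u · exp (t A)`: the differential at the identity of the orbit map `B ↦ u ∘ B`,
applied to `A`. -/
noncomputable def fundamental (A : gl m) (u : HomTM m M) : TangentSpace (IHom m) u :=
  mfderiv 𝓘(ℝ, gl m) (IHom m) (fun B : gl m => rightMul B u) (1 : gl m) A

/-- The curve `c` passes through `u` at time `0` with velocity `v`. -/
def HasVelocityAt (c : ℝ → HomTM m M) (u : HomTM m M) (v : TangentSpace (IHom m) u) : Prop :=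
  c 0 = u ∧ HasMFDerivAt 𝓘(ℝ, ℝ) (IHom m) c 0
    ((1 : ℝ →L[ℝ] ℝ).smulRight (show TangentSpace (IHom m) (c 0) from v))

/-- A smooth `GL(m, ℝ)`-invariant vector field on `LM`. -/
def IsInvariantField (Ξ : ∀ u : HomTM m M, TangentSpace (IHom m) u) : Prop :=
  ContMDiffOn (IHom m) (IHom m).tangent ∞
      (fun u => (⟨u, Ξ u⟩ : TangentBundle (IHom m) (HomTM m M))) (LM m M) ∧
    ∀ u ∈ LM m M, ∀ a : GLm m,
      mfderiv (IHom m) (IHom m) (rightMul (a : gl m)) u (Ξ u) = Ξ (rightMul (a : gl m) u)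

/-- `P` is a reduction to the closed subgroup `G` of the restriction of `LM` to the open set `U`: a
`G`-invariant set of frames over `U`, on whose fibres `G` is transitive, and which has a smooth
local section around every point of `U`. For `U = M` this is a `G`-structure on `M`. -/
structure IsReduction (G : Subgroup (GLm m)) (U : Set M) (P : Set (HomTM m M)) : Prop where
  subset_LM : P ⊆ LM m M
  proj_mem : ∀ u ∈ P, u.proj ∈ U
  rightMul_mem : ∀ u ∈ P, ∀ a ∈ G, rightMul (a : gl m) u ∈ P
  transitive : ∀ u ∈ P, ∀ u' ∈ P, u'.proj = u.proj → ∃ a ∈ G, u' = rightMul (a : gl m) u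
  local_section : ∀ x ∈ U, ∃ N : Set M, IsOpen N ∧ x ∈ N ∧ ∃ s : M → HomTM m M,
    ContMDiffOn (𝓡 m) (IHom m) ∞ s N ∧ ∀ y ∈ N, s y ∈ P ∧ (s y).proj = y

/-- The tangent space `T_u P`: the velocities at `u` of the curves contained in `P`. -/
def tangentOf (P : Set (HomTM m M)) (u : HomTM m M) : Set (TangentSpace (IHom m) u) :=
  {v | ∃ c : ℝ → HomTM m M, (∀ᶠ t in 𝓝 (0 : ℝ), c t ∈ P) ∧ HasVelocityAt c u v}

/-- `K` is, on `P`, the generalized Kosmann vector field of `Ξ`: the component along `T_u P` of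
`Ξ u` in the decomposition `T_u LM = T_u P ⊕ 𝓜_u`, where `𝓜_u` is spanned by the values at `u` of
the fundamental vector fields of the elements of `𝔪`. Values of `K` outside `P` are irrelevant. -/
def IsKosmann (P : Set (HomTM m M)) (𝔪 : Submodule ℝ (gl m))
    (Ξ K : ∀ u : HomTM m M, TangentSpace (IHom m) u) : Prop :=
  ∀ u ∈ P, K u ∈ tangentOf P u ∧ ∃ B ∈ 𝔪, Ξ u = K u + fundamental B u

/-- `c` is the orbit `t ↦ Φ_t u`, for small `t`, of `u ∈ P` under the flow in `P` of the vector field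
`K` on `P`. -/
def IsFlowLine (P : Set (HomTM m M)) (K : ∀ u : HomTM m M, TangentSpace (IHom m) u)
    (u : HomTM m M) (c : ℝ → HomTM m M) : Prop :=
  c 0 = u ∧ (∀ᶠ t in 𝓝 (0 : ℝ), c t ∈ P) ∧ IsMIntegralCurveAt c K 0

/-- The (restricted) reductive Lie derivative, on sections of vector bundles associated with `LM`.

A section `σ` of `LM ×_ρ V` is given by the equivariant map `f : LM → V` such that
`σ (π u) = [u, f u]`. Let `Φ_t` be the flow of the generalized Kosmann vector field `K` on `P`, over
the flow `φ_t` of the projection of `Ξ` to `M`, extended to all frames by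
`Φ_t (u · a) = Φ_t u · a`, for `u ∈ P` and `a ∈ GL(m, ℝ)`. Since `Φ_t (u · a)` lies over
`φ_t (π u)`, the induced maps act by `(Φ_{-t})_ρ (σ (φ_t (π u))) = [u · a, f (Φ_t (u · a))]`.
So the section `d/dt (Φ_{-t})_ρ ∘ σ ∘ φ_t` at `t = 0` is given by `D : LM → V`, where
`D (u · a) = d/dt f (Φ_t u · a)` at `t = 0`. The definition includes that the Kosmann vector field
and its flow exist. -/
def IsReductiveLieDeriv (P : Set (HomTM m M)) (𝔪 : Submodule ℝ (gl m))
    (Ξ : ∀ u : HomTM m M, TangentSpace (IHom m) u)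
    {V : Type*} [NormedAddCommGroup V] [NormedSpace ℝ V] (f D : HomTM m M → V) : Prop :=
  (∃ K, IsKosmann P 𝔪 Ξ K ∧ ∀ u ∈ P, ∃ c, IsFlowLine P K u c) ∧
    ∀ K, IsKosmann P 𝔪 Ξ K → ∀ u ∈ P, ∀ c, IsFlowLine P K u c → ∀ a : GLm m,
      HasDerivAt (fun t => f (rightMul (a : gl m) (c t))) (D (rightMul (a : gl m) u)) 0

/-! ### Metrics -/

variable (m M) in
/-- A (pseudo-)Riemannian metric on `M` of signature `(p, m - p)`. -/
structure SignatureMetric (p : ℕ) where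
  val (x : M) : TangentSpace (𝓡 m) x →L[ℝ] TangentSpace (𝓡 m) x →L[ℝ] ℝ
  symm (x : M) (v w : TangentSpace (𝓡 m) x) : val x v w = val x w v
  signature (x : M) : ∃ e : Rm m ≃L[ℝ] TangentSpace (𝓡 m) x,
    ∀ v w : Rm m, val x (e v) (e w) = eta m p v w
  contMDiff : ContMDiff (𝓡 m) ((𝓡 m).prod 𝓘(ℝ, Rm m →L[ℝ] Rm m →L[ℝ] ℝ)) ∞
    (fun x => TotalSpace.mk' (Rm m →L[ℝ] Rm m →L[ℝ] ℝ)
      (E := fun x : M => TangentSpace (𝓡 m) x →L[ℝ] TangentSpace (𝓡 m) x →L[ℝ] ℝ) x (val x))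

/-- `g` as a section of the bundle `LM ×_ρ (ℝ^m ⊗ ℝ^m)^*`: its components
`g (u e_i, u e_j)` in the frame `u`. -/
noncomputable def SignatureMetric.components {p : ℕ} (g : SignatureMetric m M p) (u : HomTM m M) :
    Fin m → Fin m → ℝ :=
  fun i j => g.val u.proj (HomTM.hom u (EuclideanSpace.single i 1))
    (HomTM.hom u (EuclideanSpace.single j 1))

/-- `P` is a bundle `SO(U, g)` of orthonormal frames of `g` over `U`, with structure group
`SO(p, q)^e`. -/
def IsOrthonormalReduction {p : ℕ} (g : SignatureMetric m M p) (U : Set M)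
    (P : Set (HomTM m M)) : Prop :=
  IsReduction (SOe m p) U P ∧ ∀ u ∈ P, ∀ v w : Rm m,
    g.val u.proj (HomTM.hom u v) (HomTM.hom u w) = eta m p v w

/-! ### Natural lifts and the metric Lie derivative -/

/-- `φ` is a smooth local flow of the vector field `ξ`, for small times and near `x`. -/
def IsLocalFlow (ξ : ∀ x : M, TangentSpace (𝓡 m) x) (x : M) (φ : ℝ → M → M) : Prop :=
  ContMDiffAt (𝓘(ℝ, ℝ).prod (𝓡 m)) (𝓡 m) ∞ (fun z : ℝ × M => φ z.1 z.2) (0, x) ∧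
    (∀ᶠ y in 𝓝 x, φ 0 y = y) ∧
    ∀ᶠ z in 𝓝 ((0 : ℝ), x), HasMFDerivAt 𝓘(ℝ, ℝ) (𝓡 m) (fun s => φ s z.2) z.1
      ((1 : ℝ →L[ℝ] ℝ).smulRight (ξ (φ z.1 z.2)))

/-- The natural lift of a local diffeomorphism `φ` of `M`, sending the frame `u` to
`dφ ∘ u`. -/
noncomputable def liftMap (φ : M → M) (u : HomTM m M) : HomTM m M :=
  HomTM.mk (φ u.proj) ((mfderiv (𝓡 m) (𝓡 m) φ u.proj).comp (HomTM.hom u))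

/-- `Ξ` is the natural lift `Lξ` of `ξ` to `LM`: the generator of the natural lift of the flow of
`ξ`. -/
def IsNaturalLift (ξ : ∀ x : M, TangentSpace (𝓡 m) x)
    (Ξ : ∀ u : HomTM m M, TangentSpace (IHom m) u) : Prop :=
  ∀ u ∈ LM m M, ∀ φ : ℝ → M → M, IsLocalFlow ξ u.proj φ →
    HasVelocityAt (fun t => liftMap (φ t) u) u (Ξ u)

/-- The metric correction of the differentials `dφ_t : T_x M → T_{φ_t x} M`: the `g`-symmetric
automorphisms `b_t` of `T_x M`, continuous at `t = 0` with `b_0 = id`, for which `dφ_t ∘ b_t` is an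
isometry, that is, the square roots near the identity of the inverses of `g⁻¹ φ_t^* g`. -/
def IsMetricCorrection {p : ℕ} (g : SignatureMetric m M p) (φ : ℝ → M → M) (x : M)
    (b : ℝ → (TangentSpace (𝓡 m) x →L[ℝ] TangentSpace (𝓡 m) x)) : Prop :=
  b 0 = ContinuousLinearMap.id ℝ _ ∧ ContinuousAt b 0 ∧
    ∀ᶠ t in 𝓝 (0 : ℝ), ∀ v w : TangentSpace (𝓡 m) x,
      g.val x (b t v) w = g.val x v (b t w) ∧
        g.val (φ t x) (mfderiv (𝓡 m) (𝓡 m) (φ t) x (b t v))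
          (mfderiv (𝓡 m) (𝓡 m) (φ t) x (b t w)) = g.val x v w

/-- The metric lift `t ↦ dφ_t ∘ b_t ∘ u` of the flow of `ξ` at the frame `u`. -/
noncomputable def metricLift (φ : ℝ → M → M) (u : HomTM m M)
    (b : ℝ → (TangentSpace (𝓡 m) u.proj →L[ℝ] TangentSpace (𝓡 m) u.proj)) (t : ℝ) : HomTM m M :=
  HomTM.mk (φ t u.proj) ((mfderiv (𝓡 m) (𝓡 m) (φ t) u.proj).comp ((b t).comp (HomTM.hom u)))

/-- The metric Lie derivative of Bourguignon and Gauduchon over `U`, on sections of vector bundles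
associated with `LM`, given by equivariant maps on `LM`: the derivative at `t = 0` of the pull-back
of the section by the isometries `dφ_t ∘ b_t`. -/
def IsMetricLieDeriv {p : ℕ} (g : SignatureMetric m M p) (U : Set M)
    (ξ : ∀ x : M, TangentSpace (𝓡 m) x)
    {V : Type*} [NormedAddCommGroup V] [NormedSpace ℝ V] (f D : HomTM m M → V) : Prop :=
  ∀ u ∈ LM m M, u.proj ∈ U → ∀ φ, IsLocalFlow ξ u.proj φ →
    ∀ b, IsMetricCorrection g φ u.proj b →
      HasDerivAt (fun t => f (metricLift φ u b t)) (D u) 0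

end Frames

/-! In coordinates a frame is a pair (y, F) of a point and an invertible matrix, and GL(m) acts by F
↦ F a. A reduction P is locally {(y, S y · a) : a ∈ SO(p,q)^e} for a smooth matrix function S. For a
frame moving along P the components of g stay equal to η. This drives both halves of the theorem.

Uniqueness of the Kosmann splitting: the differentials of the components of g kill the vectors
tangent to P, and on the fundamental vector of B they give η(Bx, y) + η(x, By). Two splittings of
the same vector therefore have 𝔪-parts that differ by a skew endomorphism, hence agree
(`kosmann_unique`).

Existence of the splitting and of the flow come together (`exists_curve`). By invariance, the field
at (y, S y · a) is determined by its value at (y, S y). Splitting the vertical part into its skew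
and 𝔪 components yields an ODE y' = F₁(y), a' = A(y) a with A skew. Its solution starting at a = 1
keeps a in SO(p,q)^e, so the curve lies in P, and the defect from the field is fundamental for an
element of 𝔪 by Ad-invariance. Tangent vectors of P being velocities of curves in P, no submanifold
structure of P enters. The metric has constant components along such curves, which is the vanishing
of its Lie derivative.

For a natural lift, dφ_t ∘ b_t ∘ u = (dφ_t ∘ u) · β_t, where β_t = u⁻¹ b_t u is η-symmetric and
satisfies β H β = 1, with H the metric in the frame dφ_t ∘ u. This equation alone makes β
differentiable at 0 (`hasDerivAt_of_mul_mul_eq_one`), with symmetric derivative β'. The metric lift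
is orthonormal and close to u, so it lies in P (`eventually_mem`, through the Cayley transform). Its
velocity is thus tangent to P and differs from Ξ by the fundamental vector of β' ∈ Sym_η: by
uniqueness it is the Kosmann vector. Both Lie derivatives then differentiate the same equivariant
function along curves with the same velocity, first at frames of P, then at all frames over U by
equivariance (`exists_lieDeriv`). -/

/-! ### The standard metric -/

/-- The matrix `diag (1, …, 1, -1, …, -1)` of the standard metric, as an endomorphism. -/
noncomputable def etaJ (m p : ℕ) : gl m :=
  ∑ i : Fin m, (if (i : ℕ) < p then (1 : ℝ) else -1) •
    (EuclideanSpace.proj i : Rm m →L[ℝ] ℝ).smulRight (EuclideanSpace.single i (1 : ℝ))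

/-! ### Normed algebra structures on `gl m`. -/

section Shortcuts

/-- Shortcut instance. -/
@[reducible] noncomputable def glNormedRing (m : ℕ) : NormedRing (gl m) :=
  ContinuousLinearMap.toNormedRing

attribute [local instance] glNormedRing

/-- Shortcut instance. -/
@[reducible] noncomputable def glNormedSpace (m : ℕ) : NormedSpace ℝ (gl m) := inferInstance

attribute [local instance] glNormedSpace

/-- Shortcut instance. -/
@[reducible] noncomputable def glNormedAlgebra (m : ℕ) : NormedAlgebra ℝ (gl m) :=
  ContinuousLinearMap.toNormedAlgebra

attribute [local instance] glNormedAlgebra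

lemma gl_isScalarTower (m : ℕ) : IsScalarTower ℝ (gl m) (gl m) := ⟨fun c A B => by ext; rfl⟩

lemma gl_smulCommClass (m : ℕ) : SMulCommClass ℝ (gl m) (gl m) :=
  ⟨fun c A B => by ext1 v; exact (A.map_smul c (B v)).symm⟩

/-- Shortcut instance. -/
@[reducible] noncomputable def glAddCommGroup (m : ℕ) : AddCommGroup (gl m) := inferInstance

/-- Shortcut instance. -/
@[reducible] noncomputable def glModule (m : ℕ) : Module ℝ (gl m) := inferInstance

end Shortcuts

section Library

attribute [local instance] glNormedRing glNormedSpace glNormedAlgebra gl_isScalarTower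
  gl_smulCommClass glAddCommGroup glModule

/-! ### Adjoints, isometries and skew endomorphisms for η. -/

section LinearAlgebra

variable {m p : ℕ}

lemma etaJ_apply (v : Rm m) (i : Fin m) :
    etaJ m p v i = (if (i : ℕ) < p then (1 : ℝ) else -1) * v i := by
  simp only [etaJ, sum_apply, WithLp.ofLp_sum, Finset.sum_apply]
  rw [Finset.sum_eq_single i]
  · split_ifs <;> simp
  · intro j _ hj
    split_ifs <;> simp [Ne.symm hj]
  · simp

lemma etaJ_mul_self : etaJ m p * etaJ m p = 1 := by
  ext v i
  change etaJ m p (etaJ m p v) i = v i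
  rw [etaJ_apply, etaJ_apply]
  split_ifs <;> ring

lemma eta_eq_inner (v w : Rm m) : eta m p v w = inner ℝ (etaJ m p v) w := by
  simp only [eta, PiLp.inner_apply, etaJ_apply]
  refine Finset.sum_congr rfl fun i _ => ?_
  simp only [RCLike.inner_apply, conj_trivial]
  ring

lemma eta_comm (v w : Rm m) : eta m p v w = eta m p w v := by
  simp only [eta, mul_comm]

lemma eta_add_left (v v' w : Rm m) : eta m p (v + v') w = eta m p v w + eta m p v' w := by
  simp [eta_eq_inner, inner_add_left]

lemma eta_add_right (v w w' : Rm m) : eta m p v (w + w') = eta m p v w + eta m p v w' := by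
  simp [eta_eq_inner, inner_add_right]

lemma eta_sub_left (v v' w : Rm m) : eta m p (v - v') w = eta m p v w - eta m p v' w := by
  simp [eta_eq_inner, inner_sub_left]

lemma eta_sub_right (v w w' : Rm m) : eta m p v (w - w') = eta m p v w - eta m p v w' := by
  simp [eta_eq_inner, inner_sub_right]

lemma eta_smul_left (c : ℝ) (v w : Rm m) : eta m p (c • v) w = c * eta m p v w := by
  simp [eta_eq_inner, inner_smul_left]

lemma eta_smul_right (c : ℝ) (v w : Rm m) : eta m p v (c • w) = c * eta m p v w := by
  simp [eta_eq_inner, inner_smul_right]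

lemma eta_ext_right {v v' : Rm m} (h : ∀ w, eta m p v w = eta m p v' w) : v = v' := by
  have h1 : etaJ m p v = etaJ m p v' := ext_inner_right ℝ fun w => by
    rw [← eta_eq_inner, ← eta_eq_inner, h]
  have h2 := congrArg (etaJ m p) h1
  have h3 : ∀ x, etaJ m p (etaJ m p x) = x := fun x =>
    congrArg (fun f : gl m => f x) etaJ_mul_self
  rwa [h3, h3] at h2

/-- The adjoint of an endomorphism for the standard metric. -/
noncomputable def etaAdj (p : ℕ) (a : gl m) : gl m :=
  etaJ m p * ContinuousLinearMap.adjoint a * etaJ m p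

lemma eta_etaAdj_right (a : gl m) (v w : Rm m) : eta m p v (etaAdj p a w) = eta m p (a v) w := by
  have hJ : ∀ x y : Rm m, inner ℝ (etaJ m p x) y = inner ℝ x (etaJ m p y) := fun x y => by
    rw [← eta_eq_inner, eta_comm, eta_eq_inner, real_inner_comm]
  have h3 : ∀ x, etaJ m p (etaJ m p x) = x := fun x =>
    congrArg (fun f : gl m => f x) etaJ_mul_self
  rw [eta_eq_inner, eta_eq_inner, hJ, hJ]
  change inner ℝ v (etaJ m p (etaJ m p (ContinuousLinearMap.adjoint a (etaJ m p w)))) = _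
  rw [h3, ContinuousLinearMap.adjoint_inner_right]

lemma eta_etaAdj_left (a : gl m) (v w : Rm m) : eta m p (etaAdj p a v) w = eta m p v (a w) := by
  rw [eta_comm, eta_etaAdj_right, eta_comm]

lemma continuous_etaAdj : Continuous (etaAdj p : gl m → gl m) := by
  unfold etaAdj
  fun_prop

/-- The endomorphisms preserving the standard metric. -/
def IsEtaIsometry (p : ℕ) (a : gl m) : Prop := ∀ v w, eta m p (a v) (a w) = eta m p v w

/-- The endomorphisms that are skew for the standard metric. -/
def IsEtaSkew (p : ℕ) (A : gl m) : Prop := ∀ v w, eta m p (A v) w + eta m p v (A w) = 0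

lemma IsEtaIsometry.etaAdj_mul {a : gl m} (h : IsEtaIsometry p a) : etaAdj p a * a = 1 := by
  ext1 v
  refine eta_ext_right (p := p) fun w => ?_
  change eta m p (etaAdj p a (a v)) w = eta m p v w
  rw [eta_etaAdj_left, h]

/-- Finite dimension: a one-sided inverse of an endomorphism is two-sided. -/
lemma mul_eq_one_symm {a b : gl m} (h : a * b = 1) : b * a = 1 := by
  have h1 : (a : Rm m →ₗ[ℝ] Rm m) * (b : Rm m →ₗ[ℝ] Rm m) = 1 := by
    ext1 v
    exact congrArg (fun f : gl m => f v) h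
  ext1 v
  exact congrArg (fun f : Rm m →ₗ[ℝ] Rm m => f v) (mul_eq_one_comm.1 h1)

lemma IsEtaIsometry.mul_etaAdj {a : gl m} (h : IsEtaIsometry p a) : a * etaAdj p a = 1 :=
  mul_eq_one_symm h.etaAdj_mul

/-- The unit underlying an isometry of the standard metric. -/
noncomputable def IsEtaIsometry.unit {a : gl m} (h : IsEtaIsometry p a) : GLm m :=
  ⟨a, etaAdj p a, h.mul_etaAdj, h.etaAdj_mul⟩

/-- The adjoint is J aᵀ J, with J² = 1 and a transpose of unchanged determinant. -/
lemma det_etaAdj (a : gl m) :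
    LinearMap.det (etaAdj p a : Rm m →ₗ[ℝ] Rm m) = LinearMap.det (a : Rm m →ₗ[ℝ] Rm m) := by
  have e1 : (etaAdj p a : Rm m →ₗ[ℝ] Rm m) = (etaJ m p : Rm m →ₗ[ℝ] Rm m) *
      LinearMap.adjoint (a : Rm m →ₗ[ℝ] Rm m) * (etaJ m p : Rm m →ₗ[ℝ] Rm m) := rfl
  have e2 : (etaJ m p : Rm m →ₗ[ℝ] Rm m) * (etaJ m p : Rm m →ₗ[ℝ] Rm m) = 1 := by
    ext1 v
    exact congrArg (fun f : gl m => f v) etaJ_mul_self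
  have e3 : LinearMap.det (LinearMap.adjoint (a : Rm m →ₗ[ℝ] Rm m))
      = LinearMap.det (a : Rm m →ₗ[ℝ] Rm m) := by
    let b := EuclideanSpace.basisFun (Fin m) ℝ
    rw [← LinearMap.det_toMatrix b.toBasis, LinearMap.toMatrix_adjoint b b,
      Matrix.det_conjTranspose, LinearMap.det_toMatrix]
    simp
  have e4 := congrArg LinearMap.det e2
  rw [map_mul, map_one] at e4
  rw [e1, map_mul, map_mul, e3, mul_right_comm, e4, one_mul]

lemma IsEtaIsometry.det_sq {a : gl m} (h : IsEtaIsometry p a) :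
    LinearMap.det (a : Rm m →ₗ[ℝ] Rm m) ^ 2 = 1 := by
  have e2 : (etaAdj p a : Rm m →ₗ[ℝ] Rm m) * (a : Rm m →ₗ[ℝ] Rm m) = 1 := by
    ext1 v
    exact congrArg (fun f : gl m => f v) h.etaAdj_mul
  have e4 := congrArg LinearMap.det e2
  rwa [map_mul, map_one, det_etaAdj, ← sq] at e4

/-! ### The identity component of SO(p, q) and its Lie algebra. -/

lemma SOe_le_SOpq : SOe m p ≤ SOpq m p := by
  rintro _ ⟨a, -, rfl⟩
  exact a.2

lemma isEtaIsometry_of_mem_SOe {a : GLm m} (ha : a ∈ SOe m p) : IsEtaIsometry p (a : gl m) :=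
  (SOe_le_SOpq ha).1

/-- A continuous path of isometries of the standard metric issuing from the identity runs in the
identity component. -/
lemma exists_mem_SOe_of_path {γ : ℝ → gl m} {s : Set ℝ} (hs : IsPreconnected s)
    (hγ : ContinuousOn γ s) (hiso : ∀ t ∈ s, IsEtaIsometry p (γ t)) (h0 : (0 : ℝ) ∈ s)
    (hγ0 : γ 0 = 1) {t : ℝ} (ht : t ∈ s) : ∃ a ∈ SOe m p, (a : gl m) = γ t := by
  have hdetc : ContinuousOn (fun t => LinearMap.det (γ t : Rm m →ₗ[ℝ] Rm m)) s := by
    have := ContinuousLinearMap.continuous_det (𝕜 := ℝ) (E := Rm m)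
    exact this.comp_continuousOn hγ
  have hdet : ∀ t ∈ s, LinearMap.det (γ t : Rm m →ₗ[ℝ] Rm m) = 1 := by
    have h1 : LinearMap.det (γ 0 : Rm m →ₗ[ℝ] Rm m) = 1 := by
      rw [hγ0]
      exact LinearMap.det_id
    -- A continuous function of square 1 on a preconnected set has constant sign, fixed here by its
    -- value at 0.
    rcases hs.eq_one_or_eq_neg_one_of_sq_eq hdetc (fun t ht => (hiso t ht).det_sq) with h | h
    · exact h
    · have := h h0
      simp only [h1, Pi.neg_apply, Pi.one_apply] at this
      norm_num at this
  have : PreconnectedSpace s := isPreconnected_iff_preconnectedSpace.1 hs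
  let F : s → SOpq m p := fun t => ⟨(hiso t t.2).unit, hiso t t.2, hdet t t.2⟩
  have hF : Continuous F := by
    -- The topology on units also asks for continuity of the inverse, which is the η-adjoint.
    refine Continuous.subtype_mk (Units.continuous_iff.2 ⟨?_, ?_⟩) _
    · exact continuousOn_iff_continuous_domRestrict.1 hγ
    · exact continuous_etaAdj.comp (continuousOn_iff_continuous_domRestrict.1 hγ)
  have hF0 : F ⟨0, h0⟩ = 1 := Subtype.ext (Units.ext hγ0)
  have hmem : F ⟨t, ht⟩ ∈ connectedComponent (1 : SOpq m p) :=
    (isPreconnected_range hF).subset_connectedComponent ⟨_, hF0⟩ ⟨_, rfl⟩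
  exact ⟨_, ⟨F ⟨t, ht⟩, hmem, rfl⟩, rfl⟩

lemma hasDerivAt_eta {f g : ℝ → Rm m} {f' g' : Rm m} {t : ℝ} (hf : HasDerivAt f f' t)
    (hg : HasDerivAt g g' t) :
    HasDerivAt (fun t => eta m p (f t) (g t)) (eta m p f' (g t) + eta m p (f t) g') t := by
  simp only [eta_eq_inner]
  have h := ((etaJ m p).hasFDerivAt.comp_hasDerivAt t hf).inner ℝ hg
  rwa [add_comm] at h

lemma HasDerivAt.gl_apply {γ : ℝ → gl m} {γ' : gl m} {t : ℝ} (h : HasDerivAt γ γ' t) (v : Rm m) :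
    HasDerivAt (fun t => γ t v) (γ' v) t :=
  (ContinuousLinearMap.apply ℝ (Rm m) v).hasFDerivAt.comp_hasDerivAt t h

/-- The solution of a linear equation `a' = A a` with skew coefficients, issuing from the identity,
runs in the identity component. -/
lemma exists_mem_SOe_of_hasDerivAt {γ A : ℝ → gl m} {s : Set ℝ} (hs : IsPreconnected s)
    (hso : IsOpen s) (hγ : ∀ t ∈ s, HasDerivAt γ (A t * γ t) t) (hA : ∀ t ∈ s, IsEtaSkew p (A t))
    (h0 : (0 : ℝ) ∈ s) (hγ0 : γ 0 = 1) {t : ℝ} (ht : t ∈ s) :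
    ∃ a ∈ SOe m p, (a : gl m) = γ t := by
  refine exists_mem_SOe_of_path hs (fun t ht => (hγ t ht).continuousAt.continuousWithinAt)
    (fun t ht v w => ?_) h0 hγ0 ht
  have hd : ∀ t ∈ s, HasDerivAt (fun t => eta m p (γ t v) (γ t w)) 0 t := fun t ht => by
    have h := hasDerivAt_eta (p := p) ((hγ t ht).gl_apply v) ((hγ t ht).gl_apply w)
    have e : eta m p ((A t * γ t) v) (γ t w) + eta m p (γ t v) ((A t * γ t) w) = 0 :=
      hA t ht (γ t v) (γ t w)
    rwa [e] at h
  have h := hso.is_const_of_deriv_eq_zero (𝕜 := ℝ) hs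
    (fun t ht => (hd t ht).differentiableAt.differentiableWithinAt)
    (fun t ht => (hd t ht).deriv) ht h0
  simpa [hγ0] using h

/-- One way, differentiate the constant η(exp(tA)v, exp(tA)w) at 0; the other way, exp(tA) solves a'
= A a from the identity. From here on the Lie algebra is handled only through skewness. -/
lemma mem_lieAlg_SOe {A : gl m} : A ∈ lieAlg (SOe m p) ↔ IsEtaSkew p A := by
  constructor
  · intro h v w
    have hd := hasDerivAt_exp_smul_const (𝕂 := ℝ) A 0
    have h1 := hasDerivAt_eta (p := p) (hd.gl_apply v) (hd.gl_apply w)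
    have h2 : (fun t : ℝ => eta m p (NormedSpace.exp (t • A) v) (NormedSpace.exp (t • A) w))
        = fun _ => eta m p v w := by
      funext t
      obtain ⟨a, ha, hat⟩ := h t
      rw [← hat]
      exact isEtaIsometry_of_mem_SOe ha v w
    rw [h2] at h1
    have h3 := h1.unique (hasDerivAt_const _ _)
    simpa using h3
  · intro h t
    exact exists_mem_SOe_of_hasDerivAt (γ := fun t : ℝ => NormedSpace.exp (t • A))
      (A := fun _ => A) isPreconnected_univ isOpen_univ
      (fun t _ => hasDerivAt_exp_smul_const' (𝕂 := ℝ) A t) (fun _ _ => h) (Set.mem_univ _)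
      (by simp) (Set.mem_univ t)

lemma IsEtaSkew.add {A B : gl m} (hA : IsEtaSkew p A) (hB : IsEtaSkew p B) :
    IsEtaSkew p (A + B) := fun v w => by
  change eta m p (A v + B v) w + eta m p v (A w + B w) = 0
  rw [eta_add_left, eta_add_right]
  linarith [hA v w, hB v w]

lemma IsEtaSkew.sub {A B : gl m} (hA : IsEtaSkew p A) (hB : IsEtaSkew p B) :
    IsEtaSkew p (A - B) := fun v w => by
  change eta m p (A v - B v) w + eta m p v (A w - B w) = 0
  rw [eta_sub_left, eta_sub_right]
  linarith [hA v w, hB v w]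

lemma IsEtaSkew.smul {A : gl m} (hA : IsEtaSkew p A) (c : ℝ) : IsEtaSkew p (c • A) := fun v w => by
  change eta m p (c • A v) w + eta m p v (c • A w) = 0
  rw [eta_smul_left, eta_smul_right, ← mul_add, hA v w, mul_zero]

/-- The symmetric endomorphisms are an invariant complement of the Lie algebra of skew ones. -/
theorem isReductiveComplement_etaSymm (m p : ℕ) :
    IsReductiveComplement (SOe m p) (etaSymm m p) := by
  refine ⟨fun a ha B hB v w => ?_, fun X => ?_⟩
  · have h1 := isEtaIsometry_of_mem_SOe ha
    have h2 := isEtaIsometry_of_mem_SOe ((SOe m p).inv_mem ha)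
    have key : ∀ v, ((a⁻¹ : GLm m) : gl m) ((a : gl m) v) = v := fun v =>
      congrArg (fun f : gl m => f v) a.inv_mul
    have e1 := h2 ((a : gl m) (B (((a⁻¹ : GLm m) : gl m) v))) w
    have e2 := h2 v ((a : gl m) (B (((a⁻¹ : GLm m) : gl m) w)))
    rw [key] at e1 e2
    exact e1.symm.trans ((hB _ _).trans e2)
  -- The η-self-adjoint part of X; the remainder (X - X*)/2 is skew.
  · refine ⟨(1 / 2 : ℝ) • (X + etaAdj p X), ⟨fun v w => ?_, ?_⟩, ?_⟩
    · change eta m p ((1 / 2 : ℝ) • (X v + etaAdj p X v)) w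
        = eta m p v ((1 / 2 : ℝ) • (X w + etaAdj p X w))
      rw [eta_smul_left, eta_smul_right, eta_add_left, eta_add_right, eta_etaAdj_left,
        eta_etaAdj_right]
      ring
    · rw [mem_lieAlg_SOe]
      intro v w
      change eta m p (X v - (1 / 2 : ℝ) • (X v + etaAdj p X v)) w
        + eta m p v (X w - (1 / 2 : ℝ) • (X w + etaAdj p X w)) = 0
      rw [eta_sub_left, eta_sub_right, eta_smul_left, eta_smul_right, eta_add_left, eta_add_right,
        eta_etaAdj_left, eta_etaAdj_right]
      ring
    · rintro B ⟨hB, hXB⟩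
      rw [mem_lieAlg_SOe] at hXB
      ext1 v
      refine eta_ext_right (p := p) fun w => ?_
      have h1 := hXB v w
      change eta m p (X v - B v) w + eta m p v (X w - B w) = 0 at h1
      have h2 : eta m p (B v) w = eta m p v (B w) := hB v w
      change _ = eta m p ((1 / 2 : ℝ) • (X v + etaAdj p X v)) w
      rw [eta_smul_left, eta_add_left, eta_etaAdj_left]
      rw [eta_sub_left, eta_sub_right] at h1
      linarith

/-! ### Isometries near the identity, and differentiability of square roots. -/

/-- The isometries of the standard metric that are close to the identity belong to the identity
component. -/
lemma eventually_mem_SOe (m p : ℕ) :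
    ∀ᶠ a in 𝓝 (1 : gl m), IsEtaIsometry p a → ∃ b ∈ SOe m p, (b : gl m) = a := by
  have two_unit : IsUnit ((1 : gl m) + 1) := by
    refine ⟨⟨1 + 1, (1 / 2 : ℝ) • 1, ?_, ?_⟩, rfl⟩
    · rw [mul_smul_comm, mul_one, ← two_smul ℝ (1 : gl m), smul_smul]; norm_num
    · rw [smul_mul_assoc, one_mul, ← two_smul ℝ (1 : gl m), smul_smul]; norm_num
  have hcont : ContinuousAt (fun a : gl m => a + 1) 1 := by fun_prop
  have hU : ∀ᶠ a in 𝓝 (1 : gl m), IsUnit (a + 1) :=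
    hcont.eventually (Units.isOpen.mem_nhds two_unit)
  have hinv : ContinuousAt (fun a : gl m => (a - 1) * Ring.inverse (a + 1)) 1 := by
    have h1 : ContinuousAt (fun a : gl m => Ring.inverse (a + 1)) 1 := by
      obtain ⟨x, hx⟩ := two_unit
      refine ContinuousAt.comp (f := fun a : gl m => a + 1) (g := Ring.inverse) ?_ hcont
      rw [← hx]
      exact NormedRing.inverse_continuousAt x
    have h2 : ContinuousAt (fun a : gl m => a - 1) 1 := by fun_prop
    exact h2.mul h1
  have hN : ∀ᶠ a in 𝓝 (1 : gl m), ‖(a - 1) * Ring.inverse (a + 1)‖ < 1 := by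
    refine hinv.norm.eventually (gt_mem_nhds ?_)
    simp
  filter_upwards [hU, hN] with a hu hn ha
  -- Cayley transform of a. It is skew because a is an isometry, and it has norm below 1 because a
  -- is close to 1.
  set A : gl m := (a - 1) * Ring.inverse (a + 1) with hAdef
  have hR1 : Ring.inverse (a + 1) * (a + 1) = 1 := Ring.inverse_mul_cancel _ hu
  have hR2 : (a + 1) * Ring.inverse (a + 1) = 1 := Ring.mul_inverse_cancel _ hu
  have hAa : A * (a + 1) = a - 1 := by rw [hAdef, mul_assoc, hR1, mul_one]
  have hskew : IsEtaSkew p A := by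
    intro v w
    obtain ⟨x, hx⟩ : ∃ x, a x + x = v := ⟨Ring.inverse (a + 1) v,
      congrArg (fun f : gl m => f v) hR2⟩
    obtain ⟨y, hy⟩ : ∃ y, a y + y = w := ⟨Ring.inverse (a + 1) w,
      congrArg (fun f : gl m => f w) hR2⟩
    have e1 : A v = a x - x := hx ▸ congrArg (fun f : gl m => f x) hAa
    have e2 : A w = a y - y := hy ▸ congrArg (fun f : gl m => f y) hAa
    rw [e1, e2, ← hx, ← hy]
    simp only [eta_sub_left, eta_sub_right, eta_add_left, eta_add_right]
    linarith [ha x y]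
  have hunit : ∀ t ∈ Set.Icc (0 : ℝ) 1, IsUnit (1 - t • A) := fun t ht => by
    refine isUnit_one_sub_of_norm_lt_one ?_
    rw [norm_smul, Real.norm_of_nonneg ht.1]
    exact (mul_le_of_le_one_left (norm_nonneg _) ht.2).trans_lt hn
  -- The inverse Cayley transform of tA, for t from 0 to 1, is a path of isometries from 1 to a.
  obtain ⟨b, hb, hb1⟩ := exists_mem_SOe_of_path (p := p) (s := Set.Icc (0 : ℝ) 1)
    (γ := fun t => (1 + t • A) * Ring.inverse (1 - t • A)) isPreconnected_Icc
    (fun t ht => by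
      have h1 : ContinuousAt (fun t : ℝ => Ring.inverse (1 - t • A)) t := by
        obtain ⟨x, hx⟩ := hunit t ht
        refine ContinuousAt.comp (f := fun t : ℝ => 1 - t • A) (g := Ring.inverse) ?_
          (by fun_prop)
        rw [← hx]
        exact NormedRing.inverse_continuousAt x
      have h2 : ContinuousAt (fun t : ℝ => 1 + t • A) t := by fun_prop
      exact (h2.mul h1).continuousWithinAt)
    (fun t ht v w => by
      have hR := Ring.mul_inverse_cancel _ (hunit t ht)
      have e : ∀ v, ∃ x, x - t • A x = v ∧ Ring.inverse (1 - t • A) v = x := fun v =>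
        ⟨_, congrArg (fun f : gl m => f v) hR, rfl⟩
      obtain ⟨x, hx, hx'⟩ := e v
      obtain ⟨y, hy, hy'⟩ := e w
      change eta m p (Ring.inverse (1 - t • A) v + t • A (Ring.inverse (1 - t • A) v))
        (Ring.inverse (1 - t • A) w + t • A (Ring.inverse (1 - t • A) w)) = eta m p v w
      rw [hx', hy', ← hx, ← hy]
      simp only [eta_sub_left, eta_sub_right, eta_add_left, eta_add_right, eta_smul_left,
        eta_smul_right]
      linear_combination (2 * t) * hskew x y)
    ⟨le_rfl, zero_le_one⟩ (by simp) (t := 1) ⟨zero_le_one, le_rfl⟩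
  refine ⟨b, hb, hb1.trans ?_⟩
  have h1 : IsUnit (1 - (1 : ℝ) • A) := hunit 1 ⟨zero_le_one, le_rfl⟩
  refine h1.mul_right_cancel ?_
  simp only [one_smul] at h1 ⊢
  rw [mul_assoc, Ring.inverse_mul_cancel _ h1, mul_one]
  refine hu.mul_right_cancel ?_
  rw [mul_assoc, sub_mul, add_mul, hAa]
  noncomm_ring

/-- A curve that is continuous at `0` and solves `β H β = 1` with `β 0 = 1` is as differentiable at
`0` as `H`. -/
lemma hasDerivAt_of_mul_mul_eq_one {β H : ℝ → gl m} {H' : gl m} (hβ : ContinuousAt β 0)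
    (hβ0 : β 0 = 1) (hH : HasDerivAt H H' 0) (h : ∀ᶠ t in 𝓝 0, β t * H t * β t = 1) :
    HasDerivAt β (-(1 / 2 : ℝ) • H') 0 := by
  have hH0 : H 0 = 1 := by simpa [hβ0] using h.self_of_nhds
  have two : ((1 : gl m) + 1) = (2 : ℝ) • 1 := (two_smul ℝ _).symm
  have two_unit : IsUnit ((1 : gl m) + 1) := by
    refine ⟨⟨1 + 1, (1 / 2 : ℝ) • 1, ?_, ?_⟩, rfl⟩
    · rw [mul_smul_comm, mul_one, ← two_smul ℝ (1 : gl m), smul_smul]; norm_num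
    · rw [smul_mul_assoc, one_mul, ← two_smul ℝ (1 : gl m), smul_smul]; norm_num
  have hβ1 : ContinuousAt (fun t => β t + 1) 0 := hβ.add continuousAt_const
  have hinv : ContinuousAt (fun t => Ring.inverse (β t + 1)) 0 := by
    obtain ⟨x, hx⟩ := two_unit
    refine ContinuousAt.comp (f := fun t => β t + 1) (g := Ring.inverse) ?_ hβ1
    rw [hβ0, ← hx]
    exact NormedRing.inverse_continuousAt x
  have hU : ∀ᶠ t in 𝓝 (0 : ℝ), IsUnit (β t + 1) :=
    hβ1.eventually (Units.isOpen.mem_nhds (by simpa [hβ0] using two_unit))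
  have hinv0 : Ring.inverse (β 0 + 1) = (1 / 2 : ℝ) • (1 : gl m) := by
    refine two_unit.mul_right_cancel ?_
    rw [hβ0, Ring.inverse_mul_cancel _ two_unit, two, smul_mul_smul_comm, one_mul]
    norm_num
  -- From β H β = 1 follows β² H = 1, so β² (H - 1) = 1 - β² = -(β - 1)(β + 1). Dividing by t leaves
  -- H' times factors that are merely required to be continuous at 0.
  have key : ∀ᶠ t in 𝓝 (0 : ℝ),
      β t - 1 = -(β t * β t * (H t - 1) * Ring.inverse (β t + 1)) := by
    filter_upwards [h, hU] with t ht hu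
    refine hu.mul_right_cancel ?_
    rw [neg_mul, mul_assoc, Ring.inverse_mul_cancel _ hu, mul_one]
    have h1 : H t * β t * β t = 1 := by
      have h2 : (H t * β t) * β t = 1 := mul_eq_one_symm (by rw [← mul_assoc]; exact ht)
      exact h2
    have h3 : β t * β t * H t = 1 := mul_eq_one_symm (by rw [← mul_assoc]; exact h1)
    rw [mul_sub, h3]
    noncomm_ring
  rw [hasDerivAt_iff_tendsto_slope] at hH ⊢
  have hle : 𝓝[≠] (0 : ℝ) ≤ 𝓝 0 := nhdsWithin_le_nhds
  have hlim : Tendsto (fun t => -(β t * β t * slope H 0 t * Ring.inverse (β t + 1))) (𝓝[≠] 0)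
      (𝓝 (-(β 0 * β 0 * H' * Ring.inverse (β 0 + 1)))) :=
    (((((hβ.tendsto.mono_left hle).mul (hβ.tendsto.mono_left hle)).mul hH).mul
      (hinv.tendsto.mono_left hle))).neg
  rw [hinv0, hβ0, one_mul, one_mul, mul_smul_comm, mul_one, ← neg_smul] at hlim
  refine hlim.congr' ?_
  filter_upwards [hle key] with t ht
  rw [slope_def_module, slope_def_module, hH0, hβ0, ht, smul_neg]
  simp only [mul_smul_comm, smul_mul_assoc]

end LinearAlgebra

/-! ### Coordinates on the bundle of frames -/

section Coordinates

variable {m : ℕ} {M : Type*} [TopologicalSpace M] [ChartedSpace (Rm m) M] [IsManifold (𝓡 m) ∞ M]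

/-- The domain of the coordinates of `Hom(ℝ^m, TM)` centred at `u₀`. -/
def crdSource (u₀ : HomTM m M) : Set (HomTM m M) := (extChartAt (IHom m) u₀).source

/-- The coordinates of `Hom(ℝ^m, TM)` centred at `u₀`. -/
noncomputable def crd (u₀ w : HomTM m M) : Rm m × gl m := extChartAt (IHom m) u₀ w

/-- The coordinates of tangent vectors of `Hom(ℝ^m, TM)`. -/
noncomputable def dcrd (u₀ w : HomTM m M) : TangentSpace (IHom m) w →L[ℝ] Rm m × gl m :=
  mfderiv (IHom m) 𝓘(ℝ, Rm m × gl m) (extChartAt (IHom m) u₀) w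

/-- The point of `Hom(ℝ^m, TM)` with given coordinates. -/
noncomputable def pnt (u₀ : HomTM m M) (z : Rm m × gl m) : HomTM m M :=
  (extChartAt (IHom m) u₀).symm z

lemma mem_crdSource {u₀ w : HomTM m M} :
    w ∈ crdSource u₀ ↔ w.proj ∈ (chartAt (Rm m) u₀.proj).source := by
  rw [crdSource, extChartAt_source, FiberBundle.chartedSpace_chartAt]
  simp only [mfld_simps, Set.mem_inter_iff, Set.mem_preimage]
  exact ⟨fun h => h.2, fun h => ⟨⟨Set.mem_univ _, h⟩, h⟩⟩

lemma mem_crdSource_self (u₀ : HomTM m M) : u₀ ∈ crdSource u₀ :=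
  mem_extChartAt_source u₀

lemma isOpen_crdSource (u₀ : HomTM m M) : IsOpen (crdSource u₀) := isOpen_extChartAt_source u₀

/-- The trivialization of the Hom bundle composes with that of TM on the left and of the trivial
bundle on the right; the latter is the identity. -/
lemma crd_apply (u₀ w : HomTM m M) :
    crd u₀ w = (extChartAt (𝓡 m) u₀.proj w.proj,
      ((trivializationAt (Rm m) (TangentSpace (𝓡 m)) u₀.proj).continuousLinearMapAt ℝ w.proj).comp
        (HomTM.hom w)) := by
  rw [crd, FiberBundle.extChartAt]
  refine Prod.ext rfl ?_
  change ((trivializationAt (Rm m) (TangentSpace (𝓡 m)) u₀.proj).continuousLinearMapAt ℝ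
    w.proj).comp ((HomTM.hom w).comp ((Trivial.trivialization M (Rm m)).symmL ℝ w.proj)) = _
  rw [Trivial.symmL_trivialization]
  rfl

lemma crd_rightMul (u₀ w : HomTM m M) (A : gl m) :
    crd u₀ (rightMul A w) = ((crd u₀ w).1, (crd u₀ w).2 * A) := by
  rw [crd_apply, crd_apply]
  rfl

lemma pnt_crd {u₀ w : HomTM m M} (hw : w ∈ crdSource u₀) : pnt u₀ (crd u₀ w) = w :=
  (extChartAt (IHom m) u₀).left_inv hw

lemma rightMul_mem_crdSource {u₀ w : HomTM m M} {A : gl m} :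
    rightMul A w ∈ crdSource u₀ ↔ w ∈ crdSource u₀ := by
  rw [mem_crdSource, mem_crdSource]
  rfl

lemma crd_injOn (u₀ : HomTM m M) : Set.InjOn (crd u₀) (crdSource u₀) :=
  (extChartAt (IHom m) u₀).injOn

/-- The trivialization of TM is bijective on fibres, so being a frame is invertibility of the matrix
part. -/
lemma mem_LM_iff {u₀ w : HomTM m M} (hw : w ∈ crdSource u₀) :
    w ∈ LM m M ↔ IsUnit (crd u₀ w).2 := by
  have hb : w.proj ∈ (trivializationAt (Rm m) (TangentSpace (𝓡 m)) u₀.proj).baseSet :=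
    mem_crdSource.1 hw
  have h1 : Function.Bijective ((trivializationAt (Rm m) (TangentSpace (𝓡 m))
      u₀.proj).continuousLinearMapAt ℝ w.proj) := by
    rw [← Trivialization.coe_continuousLinearEquivAt_eq _ hb]
    exact ContinuousLinearEquiv.bijective _
  rw [ContinuousLinearMap.isUnit_iff_bijective, crd_apply]
  exact (Function.Bijective.of_comp_iff' h1 (HomTM.hom w)).symm

lemma continuousAt_crd {u₀ w : HomTM m M} (hw : w ∈ crdSource u₀) : ContinuousAt (crd u₀) w :=
  continuousAt_extChartAt' hw

lemma isOpen_LM : IsOpen (LM m M) := by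
  refine isOpen_iff_mem_nhds.2 fun u hu => ?_
  have h1 : ∀ᶠ w in 𝓝 u, IsUnit (crd u w).2 :=
    (continuousAt_crd (mem_crdSource_self u)).snd.eventually
      (Units.isOpen.mem_nhds ((mem_LM_iff (mem_crdSource_self u)).1 hu))
  filter_upwards [h1, (isOpen_crdSource u).mem_nhds (mem_crdSource_self u)] with w hw hw'
  exact (mem_LM_iff hw').2 hw

/-! ### Velocities, fundamental vectors and invariant fields in coordinates. -/

lemma dcrd_injective {u₀ w : HomTM m M} (hw : w ∈ crdSource u₀) :
    Function.Injective (dcrd u₀ w) := by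
  have := isInvertible_mfderiv_extChartAt (I := IHom m) hw
  exact this.injective

lemma hasMFDerivAt_crd {u₀ w : HomTM m M} (hw : w ∈ crdSource u₀) :
    HasMFDerivAt (IHom m) 𝓘(ℝ, Rm m × gl m) (crd u₀) w (dcrd u₀ w) := by
  exact (mdifferentiableAt_extChartAt (by simpa [crdSource] using hw)).hasMFDerivAt

/-- The curve `c` passes through `c t` with velocity `v` at time `t`. -/
abbrev HasVel (c : ℝ → HomTM m M) (t : ℝ) (v : TangentSpace (IHom m) (c t)) : Prop :=
  HasMFDerivAt 𝓘(ℝ, ℝ) (IHom m) c t ((1 : ℝ →L[ℝ] ℝ).smulRight v)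

lemma HasVel.hasDerivAt_crd {u₀ : HomTM m M} {c : ℝ → HomTM m M} {t : ℝ}
    {v : TangentSpace (IHom m) (c t)} (h : HasVel c t v) (hc : c t ∈ crdSource u₀) :
    HasDerivAt (fun s => crd u₀ (c s)) (dcrd u₀ (c t) v) t := by
  have h1 := (hasMFDerivAt_crd hc).comp t h
  have e : (dcrd u₀ (c t)).comp ((1 : ℝ →L[ℝ] ℝ).smulRight v)
      = (ContinuousLinearMap.toSpanSingleton ℝ (dcrd u₀ (c t) v) : ℝ →L[ℝ] Rm m × gl m) :=
    ContinuousLinearMap.ext fun r => (dcrd u₀ (c t)).map_smul r v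
  have h2 : HasFDerivAt (fun s => crd u₀ (c s))
      (ContinuousLinearMap.toSpanSingleton ℝ (dcrd u₀ (c t) v) : ℝ →L[ℝ] Rm m × gl m) t :=
    hasMFDerivAt_iff_hasFDerivAt.1 (e ▸ h1)
  exact h2

/-- Composition with the smooth inverse chart recovers the map from its coordinates. -/
lemma mdifferentiableAt_of_crd {E' : Type*} [NormedAddCommGroup E'] [NormedSpace ℝ E']
    {H' : Type*} [TopologicalSpace H'] {I' : ModelWithCorners ℝ E' H'} {N : Type*}
    [TopologicalSpace N] [ChartedSpace H' N] {u₀ : HomTM m M} {f : N → HomTM m M} {x : N}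
    (hf : ∀ᶠ y in 𝓝 x, f y ∈ crdSource u₀)
    (h : MDifferentiableAt I' 𝓘(ℝ, Rm m × gl m) (fun y => crd u₀ (f y)) x) :
    MDifferentiableAt I' (IHom m) f x := by
  have h1 : MDifferentiableAt 𝓘(ℝ, Rm m × gl m) (IHom m) (pnt u₀) (crd u₀ (f x)) := by
    have h2 := mdifferentiableWithinAt_extChartAt_symm (I := IHom m)
      ((extChartAt (IHom m) u₀).map_source hf.self_of_nhds)
    rwa [(IHom m).range_eq_univ, mdifferentiableWithinAt_univ] at h2
  refine (h1.comp x h).congr_of_eventuallyEq ?_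
  filter_upwards [hf] with y hy
  exact (pnt_crd hy).symm

lemma exists_hasVel_of_hasDerivAt_crd {u₀ : HomTM m M} {c : ℝ → HomTM m M} {t : ℝ}
    {z : Rm m × gl m} (hc : ∀ᶠ s in 𝓝 t, c s ∈ crdSource u₀)
    (h : HasDerivAt (fun s => crd u₀ (c s)) z t) : ∃ v, HasVel c t v ∧ dcrd u₀ (c t) v = z := by
  have h1 : MDifferentiableAt 𝓘(ℝ, ℝ) (IHom m) c t :=
    mdifferentiableAt_of_crd hc h.differentiableAt.mdifferentiableAt
  have h2 : HasVel c t (mfderiv 𝓘(ℝ, ℝ) (IHom m) c t (1 : ℝ)) := by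
    have h3 := h1.hasMFDerivAt
    have e : (1 : ℝ →L[ℝ] ℝ).smulRight (mfderiv 𝓘(ℝ, ℝ) (IHom m) c t (1 : ℝ))
        = mfderiv 𝓘(ℝ, ℝ) (IHom m) c t := by
      refine ContinuousLinearMap.ext fun (r : ℝ) => ?_
      have h4 := (mfderiv 𝓘(ℝ, ℝ) (IHom m) c t).map_smul r (1 : ℝ)
      exact h4.symm.trans (congrArg (mfderiv 𝓘(ℝ, ℝ) (IHom m) c t) (mul_one r))
    rw [HasVel, e]
    exact h3
  exact ⟨_, h2, (h2.hasDerivAt_crd hc.self_of_nhds).unique h⟩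

lemma hasVel_of_hasDerivAt_crd {u₀ : HomTM m M} {c : ℝ → HomTM m M} {t : ℝ}
    {v : TangentSpace (IHom m) (c t)} (hc : ∀ᶠ s in 𝓝 t, c s ∈ crdSource u₀)
    (h : HasDerivAt (fun s => crd u₀ (c s)) (dcrd u₀ (c t) v) t) : HasVel c t v := by
  obtain ⟨v', h1, h2⟩ := exists_hasVel_of_hasDerivAt_crd hc h
  rwa [dcrd_injective hc.self_of_nhds h2] at h1

lemma dcrd_fundamental {u₀ w : HomTM m M} (hw : w ∈ crdSource u₀) (A : gl m) :
    dcrd u₀ w (fundamental A w) = (0, (crd u₀ w).2 * A) := by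
  have e : (fun B : gl m => crd u₀ (rightMul B w)) = fun B => ((crd u₀ w).1, (crd u₀ w).2 * B) :=
    funext fun B => crd_rightMul u₀ w B
  have h1 : HasFDerivAt (fun B : gl m => crd u₀ (rightMul B w))
      ((0 : gl m →L[ℝ] Rm m).prod (ContinuousLinearMap.mul ℝ (gl m) (crd u₀ w).2)) 1 := by
    rw [e]
    exact (hasFDerivAt_const _ _).prodMk
      (ContinuousLinearMap.mul ℝ (gl m) (crd u₀ w).2).hasFDerivAt
  have h2 : MDifferentiableAt 𝓘(ℝ, gl m) (IHom m) (fun B : gl m => rightMul B w) 1 :=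
    mdifferentiableAt_of_crd (Eventually.of_forall fun B => rightMul_mem_crdSource.2 hw)
      h1.differentiableAt.mdifferentiableAt
  have h3 := (hasMFDerivAt_crd (w := rightMul 1 w) hw).comp (1 : gl m) h2.hasMFDerivAt
  have h4 := hasMFDerivAt_unique h3 (hasMFDerivAt_iff_hasFDerivAt.2 h1)
  exact congrArg (fun f : gl m →L[ℝ] Rm m × gl m => f A) h4

lemma mdifferentiableAt_rightMul (A : gl m) (w : HomTM m M) :
    MDifferentiableAt (IHom m) (IHom m) (rightMul A) w := by
  have hw := mem_crdSource_self w
  refine mdifferentiableAt_of_crd (u₀ := w) ?_ ?_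
  · filter_upwards [(isOpen_crdSource w).mem_nhds hw] with w' hw'
    exact rightMul_mem_crdSource.2 hw'
  · simp only [crd_rightMul]
    have h1 : DifferentiableAt ℝ (fun z : Rm m × gl m => (z.1, z.2 * A)) (crd w w) := by
      fun_prop
    exact h1.mdifferentiableAt.comp w (hasMFDerivAt_crd hw).mdifferentiableAt

lemma dcrd_mfderiv_rightMul {u₀ w : HomTM m M} (hw : w ∈ crdSource u₀) (A : gl m)
    (v : TangentSpace (IHom m) w) :
    dcrd u₀ (rightMul A w) (mfderiv (IHom m) (IHom m) (rightMul A) w v)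
      = ((dcrd u₀ w v).1, (dcrd u₀ w v).2 * A) := by
  have h1 := (hasMFDerivAt_crd (rightMul_mem_crdSource.2 hw)).comp w
    (mdifferentiableAt_rightMul A w).hasMFDerivAt
  let R : Rm m × gl m →L[ℝ] Rm m × gl m := (ContinuousLinearMap.fst ℝ (Rm m) (gl m)).prod
    (((ContinuousLinearMap.mul ℝ (gl m)).flip A).comp (ContinuousLinearMap.snd ℝ (Rm m) (gl m)))
  have h2 := (R.hasFDerivAt (x := crd u₀ w)).hasMFDerivAt.comp w (hasMFDerivAt_crd hw)
  have e : crd u₀ ∘ rightMul A = R ∘ crd u₀ := funext fun w' => crd_rightMul u₀ w' A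
  rw [e] at h1
  have h3 := hasMFDerivAt_unique h1 h2
  exact congrArg (fun f : TangentSpace (IHom m) w →L[ℝ] Rm m × gl m => f v) h3

/-- A vector field on the bundle of frames in coordinates centred at `u₀`. -/
noncomputable def fieldCrd (Ξ : ∀ u : HomTM m M, TangentSpace (IHom m) u) (u₀ : HomTM m M)
    (z : Rm m × gl m) : Rm m × gl m :=
  dcrd u₀ (pnt u₀ z) (Ξ (pnt u₀ z))

/-- The trivialization of the tangent bundle at u₀ is the differential of the chart, so this is the
local representative of a smooth section. -/
lemma IsInvariantField.contDiffAt_fieldCrd {Ξ : ∀ u : HomTM m M, TangentSpace (IHom m) u}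
    (hΞ : IsInvariantField Ξ) {u₀ : HomTM m M} (hu₀ : u₀ ∈ LM m M) :
    ContDiffAt ℝ ∞ (fieldCrd Ξ u₀) (crd u₀ u₀) := by
  have h1 := (hΞ.1.contMDiffAt (isOpen_LM.mem_nhds hu₀))
  rw [contMDiffAt_totalSpace] at h1
  have h2 : ContMDiffAt (IHom m) 𝓘(ℝ, Rm m × gl m) ∞ (fun w => dcrd u₀ w (Ξ w)) u₀ := by
    refine h1.2.congr_of_eventuallyEq ?_
    filter_upwards [(isOpen_crdSource u₀).mem_nhds (mem_crdSource_self u₀)] with w hw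
    rw [crdSource, extChartAt_source] at hw
    rw [dcrd, ← TangentBundle.continuousLinearMapAt_trivializationAt hw]
    exact congrFun (Trivialization.coe_linearMapAt_of_mem (R := ℝ)
      (trivializationAt (Rm m × gl m) (TangentSpace (IHom m)) u₀) hw) (Ξ w)
  have h3 : ContMDiffAt 𝓘(ℝ, Rm m × gl m) (IHom m) ∞ (pnt u₀) (crd u₀ u₀) :=
    (contMDiffOn_extChartAt_symm u₀).contMDiffAt (extChartAt_target_mem_nhds u₀)
  have e : pnt u₀ (crd u₀ u₀) = u₀ := pnt_crd (mem_crdSource_self u₀)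
  exact (h2.comp_of_eq h3 e).contDiffAt

/-- Invariance in coordinates: the base part is unchanged and the matrix part is multiplied by a.
This reduces the field on P to its values along one local section. -/
lemma IsInvariantField.fieldCrd_mul {Ξ : ∀ u : HomTM m M, TangentSpace (IHom m) u}
    (hΞ : IsInvariantField Ξ) {u₀ w : HomTM m M} (hw : w ∈ LM m M) (hw' : w ∈ crdSource u₀)
    (a : GLm m) : dcrd u₀ (rightMul (a : gl m) w) (Ξ (rightMul (a : gl m) w))
      = ((dcrd u₀ w (Ξ w)).1, (dcrd u₀ w (Ξ w)).2 * a) := by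
  rw [← hΞ.2 w hw a, dcrd_mfderiv_rightMul hw']

/-! ### The right action in coordinates, and derivatives along curves. -/

lemma rightMul_rightMul (A B : gl m) (w : HomTM m M) :
    rightMul A (rightMul B w) = rightMul (B * A) w := rfl

lemma rightMul_one (w : HomTM m M) : rightMul 1 w = w := rfl

lemma exists_rightMul_eq {u w : HomTM m M} (hu : u ∈ LM m M) (hw : w ∈ LM m M)
    (h : w.proj = u.proj) : ∃ a : GLm m, w = rightMul (a : gl m) u := by
  have hu' := mem_crdSource_self u
  have hw' : w ∈ crdSource u := mem_crdSource.2 (by rw [h]; exact mem_crdSource.1 hu')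
  obtain ⟨x, hx⟩ := (mem_LM_iff hu').1 hu
  obtain ⟨y, hy⟩ := (mem_LM_iff hw').1 hw
  refine ⟨x⁻¹ * y, crd_injOn u hw' (rightMul_mem_crdSource.2 hu') ?_⟩
  rw [crd_rightMul, ← hx, Units.val_mul, Units.mul_inv_cancel_left, hy]
  refine Prod.ext ?_ rfl
  rw [crd_apply, crd_apply, h]

lemma pnt_mem_crdSource_of_fst {u₀ : HomTM m M} {y : Rm m} (F : gl m)
    (hy : y ∈ (extChartAt (𝓡 m) u₀.proj).target) :
    pnt u₀ (y, F) ∈ crdSource u₀ ∧ crd u₀ (pnt u₀ (y, F)) = (y, F) := by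
  have h : (y, F) ∈ (extChartAt (IHom m) u₀).target := by
    rw [FiberBundle.extChartAt_target]
    refine ⟨⟨hy, ?_⟩, Set.mem_univ _⟩
    refine ⟨Set.mem_univ _, ?_⟩
    have := (extChartAt (𝓡 m) u₀.proj).map_target hy
    rwa [extChartAt_source] at this
  exact ⟨(extChartAt (IHom m) u₀).map_target h, (extChartAt (IHom m) u₀).right_inv h⟩

lemma rightMul_pnt {u₀ : HomTM m M} {y : Rm m} (F A : gl m)
    (hy : y ∈ (extChartAt (𝓡 m) u₀.proj).target) :
    rightMul A (pnt u₀ (y, F)) = pnt u₀ (y, F * A) := by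
  obtain ⟨h1, h2⟩ := pnt_mem_crdSource_of_fst F hy
  obtain ⟨h3, h4⟩ := pnt_mem_crdSource_of_fst (F * A) hy
  refine crd_injOn u₀ (rightMul_mem_crdSource.2 h1) h3 ?_
  rw [crd_rightMul, h2, h4]

lemma HasVel.comp_rightMul {c : ℝ → HomTM m M} {t : ℝ} {v : TangentSpace (IHom m) (c t)}
    (h : HasVel c t v) (A : gl m) :
    HasVel (fun s => rightMul A (c s)) t
      (mfderiv (IHom m) (IHom m) (rightMul A) (c t) v) := by
  have h1 := (mdifferentiableAt_rightMul A (c t)).hasMFDerivAt.comp t h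
  have e : (mfderiv (IHom m) (IHom m) (rightMul A) (c t)).comp
      ((1 : ℝ →L[ℝ] ℝ).smulRight v)
      = (1 : ℝ →L[ℝ] ℝ).smulRight (mfderiv (IHom m) (IHom m) (rightMul A) (c t) v) :=
    ContinuousLinearMap.ext fun r =>
      (mfderiv (IHom m) (IHom m) (rightMul A) (c t)).map_smul r v
  exact HasMFDerivAt.congr_mfderiv h1 e

lemma HasVel.hasDerivAt_comp {V : Type*} [NormedAddCommGroup V] [NormedSpace ℝ V]
    {f : HomTM m M → V} {c : ℝ → HomTM m M} {t : ℝ} {v : TangentSpace (IHom m) (c t)}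
    (h : HasVel c t v) (hf : MDifferentiableAt (IHom m) 𝓘(ℝ, V) f (c t)) :
    HasDerivAt (fun s => f (c s)) (mfderiv (IHom m) 𝓘(ℝ, V) f (c t) v) t := by
  have h1 := hf.hasMFDerivAt.comp t h
  have e : (mfderiv (IHom m) 𝓘(ℝ, V) f (c t)).comp ((1 : ℝ →L[ℝ] ℝ).smulRight v)
      = (ContinuousLinearMap.toSpanSingleton ℝ (mfderiv (IHom m) 𝓘(ℝ, V) f (c t) v) :
        ℝ →L[ℝ] V) :=
    ContinuousLinearMap.ext fun r => (mfderiv (IHom m) 𝓘(ℝ, V) f (c t)).map_smul r v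
  have h2 : HasFDerivAt (fun s => f (c s)) (ContinuousLinearMap.toSpanSingleton ℝ
      (mfderiv (IHom m) 𝓘(ℝ, V) f (c t) v) : ℝ →L[ℝ] V) t :=
    hasMFDerivAt_iff_hasFDerivAt.1 (e ▸ h1)
  exact h2

/-! ### The pairing of frames by a metric -/

/-- The components of a metric in frames. -/
noncomputable def pairing {p : ℕ} (g : SignatureMetric m M p) (v w : Rm m) (u : HomTM m M) : ℝ :=
  g.val u.proj (HomTM.hom u v) (HomTM.hom u w)

/-- Evaluating the tautological homomorphism u at a constant vector is a smooth map into TM, and g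
is smooth on pairs of such maps. -/
lemma contMDiff_pairing {p : ℕ} (g : SignatureMetric m M p) (v w : Rm m) :
    ContMDiff (IHom m) 𝓘(ℝ, ℝ) ∞ (pairing g v w) := by
  have hproj : ContMDiff (IHom m) (𝓡 m) ∞ (fun u : HomTM m M => u.proj) :=
    Bundle.contMDiff_proj _
  have hev : ∀ v : Rm m, ContMDiff (IHom m) ((𝓡 m).prod 𝓘(ℝ, Rm m)) ∞
      (fun u : HomTM m M => TotalSpace.mk' (Rm m) (E := fun x : M => TangentSpace (𝓡 m) x)
        u.proj (HomTM.hom u v)) := by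
    intro v
    have hid : ContMDiff (IHom m) (IHom m) ∞ (fun u : HomTM m M =>
        TotalSpace.mk' (Rm m →L[ℝ] Rm m)
          (E := fun x : M => Trivial M (Rm m) x →L[ℝ] TangentSpace (𝓡 m) x) u.proj u.snd) :=
      contMDiff_id
    have hv : ContMDiff (IHom m) ((𝓡 m).prod 𝓘(ℝ, Rm m)) ∞ (fun u : HomTM m M =>
        TotalSpace.mk' (Rm m) (E := Trivial M (Rm m)) u.proj v) := by
      intro u
      rw [contMDiffAt_totalSpace]
      exact ⟨hproj u, contMDiffAt_const⟩
    exact hid.clm_bundle_apply hv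
  have hg := g.contMDiff.comp hproj
  have h := ContMDiff.clm_bundle_apply₂ (E₃ := Trivial M ℝ) (F₃ := ℝ) hg (hev v) (hev w)
  intro u
  exact (contMDiffAt_totalSpace.1 (h u)).2

lemma pairing_rightMul {p : ℕ} (g : SignatureMetric m M p) (v w : Rm m) (A : gl m)
    (u : HomTM m M) : pairing g v w (rightMul A u) = pairing g (A v) (A w) u := rfl

end Coordinates

/-! ### Orthonormal reductions -/

section Reductions

variable {m p : ℕ} {M : Type*} [TopologicalSpace M] [ChartedSpace (Rm m) M]
  [IsManifold (𝓡 m) ∞ M] {g : SignatureMetric m M p} {U : Set M} {P : Set (HomTM m M)}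

lemma hasVelocityAt_of_crd {u₀ u : HomTM m M} {c : ℝ → HomTM m M} {v : TangentSpace (IHom m) u}
    (h0 : c 0 = u) (hc : ∀ᶠ s in 𝓝 0, c s ∈ crdSource u₀)
    (h : HasDerivAt (fun s => crd u₀ (c s)) (dcrd u₀ u v) 0) : HasVelocityAt c u v := by
  subst h0
  exact ⟨rfl, hasVel_of_hasDerivAt_crd hc h⟩

lemma HasVelocityAt.hasDerivAt_comp {V : Type*} [NormedAddCommGroup V] [NormedSpace ℝ V]
    {f : HomTM m M → V} {c : ℝ → HomTM m M} {u : HomTM m M} {v : TangentSpace (IHom m) u}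
    (h : HasVelocityAt c u v) (hf : MDifferentiableAt (IHom m) 𝓘(ℝ, V) f u) :
    HasDerivAt (fun s => f (c s)) (mfderiv (IHom m) 𝓘(ℝ, V) f u v) 0 := by
  obtain ⟨rfl, h⟩ := h
  exact HasVel.hasDerivAt_comp h hf

lemma HasVelocityAt.hasDerivAt_crd {u₀ : HomTM m M} {c : ℝ → HomTM m M} {u : HomTM m M}
    {v : TangentSpace (IHom m) u} (h : HasVelocityAt c u v) (hc : u ∈ crdSource u₀) :
    HasDerivAt (fun s => crd u₀ (c s)) (dcrd u₀ u v) 0 := by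
  obtain ⟨rfl, h⟩ := h
  exact HasVel.hasDerivAt_crd h hc

lemma HasVelocityAt.tendsto {c : ℝ → HomTM m M} {u : HomTM m M}
    {v : TangentSpace (IHom m) u} (h : HasVelocityAt c u v) : Tendsto c (𝓝 0) (𝓝 u) := by
  obtain ⟨rfl, h⟩ := h
  exact HasMFDerivAt.continuousAt h

lemma hasVelocityAt_fundamental (A : gl m) (u : HomTM m M) :
    HasVelocityAt (fun t : ℝ => rightMul (1 + t • A) u) u (fundamental A u) := by
  have hu := mem_crdSource_self u
  refine hasVelocityAt_of_crd (u₀ := u) ?_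
    (Eventually.of_forall fun t => rightMul_mem_crdSource.2 hu) ?_
  · simp only [zero_smul, add_zero, rightMul_one]
  · simp only [crd_rightMul]
    rw [dcrd_fundamental hu]
    have h1 : HasDerivAt (fun t : ℝ => 1 + t • A) A 0 := by
      simpa using ((hasDerivAt_id (0 : ℝ)).smul_const A).const_add 1
    exact (hasDerivAt_const _ _).prodMk (h1.const_mul _)

lemma fundamental_neg (A : gl m) (u : HomTM m M) : fundamental (-A) u = -fundamental A u :=
  (mfderiv 𝓘(ℝ, gl m) (IHom m) (fun B : gl m => rightMul B u) (1 : gl m)).map_neg A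

lemma mdifferentiableAt_pairing (g : SignatureMetric m M p) (x y : Rm m) (u : HomTM m M) :
    MDifferentiableAt (IHom m) 𝓘(ℝ, ℝ) (pairing g x y) u :=
  (contMDiff_pairing g x y u).mdifferentiableAt (by simp)

lemma IsOrthonormalReduction.pairing_eq (hP : IsOrthonormalReduction g U P) {u : HomTM m M}
    (hu : u ∈ P) (x y : Rm m) : pairing g x y u = eta m p x y :=
  hP.2 u hu x y

/-- The components of g are constant along curves in P, so their differentials annihilate tangent
vectors of P. -/
lemma IsOrthonormalReduction.mfderiv_pairing_tangent (hP : IsOrthonormalReduction g U P)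
    {u : HomTM m M} {v : TangentSpace (IHom m) u} (hv : v ∈ tangentOf P u) (x y : Rm m) :
    mfderiv (IHom m) 𝓘(ℝ, ℝ) (pairing g x y) u v = (0 : ℝ) := by
  obtain ⟨c, hc, h⟩ := hv
  refine (h.hasDerivAt_comp (mdifferentiableAt_pairing g x y u)).unique ?_
  refine (hasDerivAt_const (0 : ℝ) (eta m p x y)).congr_of_eventuallyEq ?_
  filter_upwards [hc] with t ht
  exact hP.pairing_eq ht x y

lemma IsOrthonormalReduction.mfderiv_pairing_fundamental (hP : IsOrthonormalReduction g U P)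
    {u : HomTM m M} (hu : u ∈ P) (A : gl m) (x y : Rm m) :
    mfderiv (IHom m) 𝓘(ℝ, ℝ) (pairing g x y) u (fundamental A u)
      = eta m p (A x) y + eta m p x (A y) := by
  have h1 := (hasVelocityAt_fundamental A u).hasDerivAt_comp (mdifferentiableAt_pairing g x y u)
  simp only [pairing_rightMul, hP.pairing_eq hu] at h1
  have h2 : HasDerivAt (fun t : ℝ => 1 + t • A) A 0 := by
    simpa using ((hasDerivAt_id (0 : ℝ)).smul_const A).const_add 1
  have h3 := hasDerivAt_eta (p := p) (h2.gl_apply x) (h2.gl_apply y)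
  have h4 := h1.unique h3
  simp only [zero_smul, add_zero] at h4
  exact h4

/-- The decomposition that defines the generalized Kosmann vector field is unique. -/
lemma IsOrthonormalReduction.kosmann_unique (hP : IsOrthonormalReduction g U P)
    {𝔪 : Submodule ℝ (gl m)} (h𝔪 : IsReductiveComplement (SOe m p) 𝔪) {u : HomTM m M} (hu : u ∈ P)
    {v v' : TangentSpace (IHom m) u} (hv : v ∈ tangentOf P u) (hv' : v' ∈ tangentOf P u)
    {B B' : gl m} (hB : B ∈ 𝔪) (hB' : B' ∈ 𝔪)
    (h : v + fundamental B u = v' + fundamental B' u) : v = v' := by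
  have hskew : IsEtaSkew p (B - B') := fun x y => by
    let dp : TangentSpace (IHom m) u →L[ℝ] ℝ := mfderiv (IHom m) 𝓘(ℝ, ℝ) (pairing g x y) u
    have e1 : dp v = 0 := hP.mfderiv_pairing_tangent hv x y
    have e2 : dp v' = 0 := hP.mfderiv_pairing_tangent hv' x y
    have e3 : dp (fundamental B u) = _ := hP.mfderiv_pairing_fundamental hu B x y
    have e4 : dp (fundamental B' u) = _ := hP.mfderiv_pairing_fundamental hu B' x y
    have h1 := congrArg dp h
    rw [dp.map_add, dp.map_add, e1, e2, e3, e4, zero_add, zero_add] at h1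
    change eta m p (B x - B' x) y + eta m p x (B y - B' y) = 0
    rw [eta_sub_left, eta_sub_right]
    linarith
  -- Both B and B' are 𝔪-components of B: the remainders 0 and B - B' are skew.
  have hBB : B = B' := (h𝔪.2 B).unique
    ⟨hB, mem_lieAlg_SOe.2 (by rw [sub_self]; intro x y; simp [eta])⟩
    ⟨hB', mem_lieAlg_SOe.2 hskew⟩
  subst hBB
  exact add_right_cancel h

/-! ### Local sections and orthonormal frames near the reduction. -/

/-- A local section of a reduction in coordinates. -/
lemma IsOrthonormalReduction.exists_section (hP : IsOrthonormalReduction g U P) {u : HomTM m M}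
    (hu : u ∈ P) : ∃ S : Rm m → gl m, ContDiffAt ℝ ∞ S (crd u u).1 ∧
      S (crd u u).1 = (crd u u).2 ∧ ∀ᶠ y in 𝓝 (crd u u).1,
        y ∈ (extChartAt (𝓡 m) u.proj).target ∧ pnt u (y, S y) ∈ P := by
  obtain ⟨N, hN, hxN, s, hs, hsN⟩ := hP.1.local_section u.proj (hP.1.proj_mem u hu)
  obtain ⟨hsP, hsx⟩ := hsN _ hxN
  obtain ⟨a, ha, hua⟩ := hP.1.transitive _ hsP u hu hsx.symm
  have hy0 : (crd u u).1 = extChartAt (𝓡 m) u.proj u.proj := by rw [crd_apply]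
  have hx0 : (extChartAt (𝓡 m) u.proj).symm (crd u u).1 = u.proj := by
    rw [hy0]
    exact (extChartAt (𝓡 m) u.proj).left_inv (mem_extChartAt_source _)
  have htgt : ∀ᶠ y in 𝓝 (crd u u).1, y ∈ (extChartAt (𝓡 m) u.proj).target := by
    rw [hy0]
    exact extChartAt_target_mem_nhds u.proj
  have hsymm : ContMDiffAt 𝓘(ℝ, Rm m) (𝓡 m) ∞ (extChartAt (𝓡 m) u.proj).symm (crd u u).1 :=
    (contMDiffOn_extChartAt_symm u.proj).contMDiffAt htgt
  -- A constant element a of the structure group makes the section pass through u.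
  refine ⟨fun y => (crd u (s ((extChartAt (𝓡 m) u.proj).symm y))).2 * a, ?_, ?_, ?_⟩
  · have h1 : ContMDiffAt (𝓡 m) (IHom m) ∞ s u.proj := hs.contMDiffAt (hN.mem_nhds hxN)
    have h2 : ContMDiffAt (IHom m) 𝓘(ℝ, Rm m × gl m) ∞ (crd u) (s u.proj) := by
      refine contMDiffAt_extChartAt' ?_
      have h3 : s u.proj ∈ crdSource u := mem_crdSource.2 (by
        rw [hsx]; exact mem_crdSource.1 (mem_crdSource_self u))
      rwa [crdSource, extChartAt_source] at h3
    have h3 := (h2.comp_of_eq (h1.comp_of_eq hsymm hx0) (by rw [Function.comp_apply, hx0]))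
    have h4 : ContDiffAt ℝ ∞ (fun y => crd u (s ((extChartAt (𝓡 m) u.proj).symm y)))
      (crd u u).1 := h3.contDiffAt
    exact h4.snd.mul contDiffAt_const
  · beta_reduce
    conv_rhs => rw [hua, crd_rightMul]
    rw [hx0, ← hua]
  · have hev : ∀ᶠ y in 𝓝 (crd u u).1, (extChartAt (𝓡 m) u.proj).symm y ∈ N :=
      hsymm.continuousAt.eventually (hN.mem_nhds (by rw [hx0]; exact hxN))
    filter_upwards [htgt, hev] with y hy hyN
    refine ⟨hy, ?_⟩
    obtain ⟨h1, h2⟩ := hsN _ hyN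
    have h3 : s ((extChartAt (𝓡 m) u.proj).symm y) ∈ crdSource u := by
      rw [mem_crdSource, h2, ← extChartAt_source (𝓡 m)]
      exact (extChartAt (𝓡 m) u.proj).map_target hy
    have h4 : crd u (rightMul (a : gl m) (s ((extChartAt (𝓡 m) u.proj).symm y)))
        = (y, (crd u (s ((extChartAt (𝓡 m) u.proj).symm y))).2 * a) := by
      rw [crd_rightMul]
      refine Prod.ext ?_ rfl
      change (crd u (s ((extChartAt (𝓡 m) u.proj).symm y))).1 = y
      rw [crd_apply, h2]
      exact (extChartAt (𝓡 m) u.proj).right_inv hy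
    rw [← h4, pnt_crd (rightMul_mem_crdSource.2 h3)]
    exact hP.1.rightMul_mem _ h1 a ha

lemma IsOrthonormalReduction.isUnit_crd (hP : IsOrthonormalReduction g U P) {u w : HomTM m M}
    (hw : w ∈ P) (hwu : w ∈ crdSource u) : IsUnit (crd u w).2 :=
  (mem_LM_iff hwu).1 (hP.1.subset_LM hw)

/-- Orthonormal frames that are close to a frame of the reduction belong to the reduction. -/
lemma IsOrthonormalReduction.eventually_mem (hP : IsOrthonormalReduction g U P) {u : HomTM m M}
    (hu : u ∈ P) : ∀ᶠ w in 𝓝 u, (∀ x y, pairing g x y w = eta m p x y) → w ∈ P := by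
  obtain ⟨S, hS, hS0, hSP⟩ := hP.exists_section hu
  have huu := mem_crdSource_self u
  have hcrd : ContinuousAt (crd u) u := continuousAt_crd huu
  have hS1 : ContinuousAt (fun w => S (crd u w).1) u :=
    ContinuousAt.comp (f := fun w => (crd u w).1) hS.continuousAt hcrd.fst
  obtain ⟨a, ha⟩ := hP.isUnit_crd hu huu
  -- The matrix carrying the section frame at the same base point to w; it tends to 1 as w tends to
  -- u, and it is an isometry when w is orthonormal.
  have hA : ContinuousAt (fun w => Ring.inverse (S (crd u w).1) * (crd u w).2) u := by
    refine ContinuousAt.mul (ContinuousAt.comp (g := Ring.inverse) ?_ hS1) hcrd.snd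
    rw [hS0, ← ha]
    exact NormedRing.inverse_continuousAt a
  have hA1 : Ring.inverse (S (crd u u).1) * (crd u u).2 = 1 := by
    rw [hS0, ← ha, Ring.inverse_mul_cancel _ a.isUnit]
  have hA' : Tendsto (fun w => Ring.inverse (S (crd u w).1) * (crd u w).2) (𝓝 u)
      (𝓝 (1 : gl m)) := by
    rw [← hA1]
    exact hA
  have hA2 := hA'.eventually (eventually_mem_SOe m p)
  filter_upwards [(isOpen_crdSource u).mem_nhds huu, hcrd.fst.eventually hSP, hA2]
    with w hw ⟨hy, hyP⟩ hwA hiso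
  obtain ⟨h1, h2⟩ := pnt_mem_crdSource_of_fst (S (crd u w).1) hy
  have hunit : IsUnit (S (crd u w).1) := by
    have := hP.isUnit_crd hyP h1
    rwa [h2] at this
  have hw' : w = rightMul (Ring.inverse (S (crd u w).1) * (crd u w).2)
      (pnt u ((crd u w).1, S (crd u w).1)) := by
    rw [rightMul_pnt _ _ hy, ← mul_assoc, Ring.mul_inverse_cancel _ hunit, one_mul]
    exact (pnt_crd hw).symm
  obtain ⟨b, hb, hbA⟩ := hwA fun x y => by
    rw [← hiso x y, ← hP.pairing_eq hyP, ← pairing_rightMul, ← hw']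
  rw [hw', ← hbA]
  exact hP.1.rightMul_mem _ hyP b hb

/-! ### The generalized Kosmann vector field and its flow. -/

/-- The projection onto an invariant complement, along the Lie algebra. -/
lemma IsReductiveComplement.exists_projection {𝔪 : Submodule ℝ (gl m)}
    (h𝔪 : IsReductiveComplement (SOe m p) 𝔪) :
    ∃ pr : gl m →L[ℝ] gl m, ∀ X, pr X ∈ 𝔪 ∧ IsEtaSkew p (X - pr X) := by
  choose f hf huniq using h𝔪.2
  simp only [mem_lieAlg_SOe] at hf huniq
  let pr : gl m →ₗ[ℝ] gl m :=
    { toFun := f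
      map_add' := fun X Y => (huniq _ _ ⟨𝔪.add_mem (hf X).1 (hf Y).1, by
        rw [add_sub_add_comm]; exact (hf X).2.add (hf Y).2⟩).symm
      map_smul' := fun c X => (huniq _ _ ⟨𝔪.smul_mem c (hf X).1, by
        rw [← smul_sub]; exact (hf X).2.smul c⟩).symm }
  exact ⟨LinearMap.toContinuousLinearMap pr, hf⟩

/-- Through every frame of the reduction runs a curve in the reduction whose velocities are the
components along the reduction of an invariant vector field. -/
lemma IsOrthonormalReduction.exists_curve (hP : IsOrthonormalReduction g U P)
    {𝔪 : Submodule ℝ (gl m)} (h𝔪 : IsReductiveComplement (SOe m p) 𝔪)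
    {Ξ : ∀ u : HomTM m M, TangentSpace (IHom m) u} (hΞ : IsInvariantField Ξ) {u : HomTM m M}
    (hu : u ∈ P) : ∃ c : ℝ → HomTM m M, c 0 = u ∧ (∀ᶠ t in 𝓝 0, c t ∈ P) ∧
      ∀ᶠ t in 𝓝 0, ∃ v, HasVel c t v ∧ ∃ B ∈ 𝔪, Ξ (c t) = v + fundamental B (c t) := by
  obtain ⟨S, hS, hS0, hSP⟩ := hP.exists_section hu
  obtain ⟨pr, hpr⟩ := h𝔪.exists_projection
  have huu := mem_crdSource_self u
  have hSu : IsUnit (S (crd u u).1) := by rw [hS0]; exact hP.isUnit_crd hu huu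
  let F : Rm m → Rm m × gl m := fun y => fieldCrd Ξ u (y, S y)
  -- The vertical part of the field relative to the section. Along (y, S y · a) with y' = F₁, the
  -- requirement Ξ = velocity + fundamental B reads α a = a' + a B; its solution is a' = (α - pr α)
  -- a, B = a⁻¹ (pr α) a.
  let α : Rm m → gl m := fun y => Ring.inverse (S y) * ((F y).2 - fderiv ℝ S y (F y).1)
  let f : Rm m × gl m → Rm m × gl m := fun z => ((F z.1).1, (α z.1 - pr (α z.1)) * z.2)
  have hF : ContDiffAt ℝ 1 F (crd u u).1 := by
    have h1 : ContDiffAt ℝ ∞ (fieldCrd Ξ u) ((crd u u).1, S (crd u u).1) := by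
      rw [hS0]
      exact hΞ.contDiffAt_fieldCrd (hP.1.subset_LM hu)
    have h2 : ContDiffAt ℝ ∞ F (crd u u).1 :=
      ContDiffAt.comp (g := fieldCrd Ξ u) (f := fun y => (y, S y)) (crd u u).1 h1
        (contDiffAt_id.prodMk hS)
    exact h2.of_le (by exact_mod_cast le_top)
  have hdS : ContDiffAt ℝ 1 (fderiv ℝ S) (crd u u).1 :=
    hS.fderiv_right (m := 1) (WithTop.coe_le_coe.2 (le_top : (1 + 1 : ℕ∞) ≤ ⊤))
  have hSinv : ContDiffAt ℝ 1 (fun y => Ring.inverse (S y)) (crd u u).1 := by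
    obtain ⟨a, ha⟩ := hSu
    refine ContDiffAt.comp (g := Ring.inverse) _ ?_ (hS.of_le (by exact_mod_cast le_top))
    rw [← ha]
    exact contDiffAt_ringInverse ℝ a
  have hα : ContDiffAt ℝ 1 α (crd u u).1 :=
    hSinv.mul (hF.snd.sub (hdS.clm_apply hF.fst))
  have hf : ContDiffAt ℝ 1 f ((crd u u).1, (1 : gl m)) := by
    have h1 : ContDiffAt ℝ 1 (fun z : Rm m × gl m => F z.1) ((crd u u).1, (1 : gl m)) :=
      ContDiffAt.comp (g := F) ((crd u u).1, (1 : gl m)) hF contDiffAt_fst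
    have h2 : ContDiffAt ℝ 1 (fun z : Rm m × gl m => α z.1) ((crd u u).1, (1 : gl m)) :=
      ContDiffAt.comp (g := α) ((crd u u).1, (1 : gl m)) hα contDiffAt_fst
    exact h1.fst.prodMk ((h2.sub (pr.contDiff.contDiffAt.comp _ h2)).mul contDiffAt_snd)
  obtain ⟨z, hz0, ε, hε, hz⟩ :=
    hf.exists_forall_mem_closedBall_exists_eq_forall_mem_Ioo_hasDerivAt₀ 0
  simp only [zero_sub, zero_add] at hz
  have hzc : ContinuousAt z 0 := (hz 0 ⟨by linarith, hε⟩).continuousAt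
  have hgood : ∀ᶠ t in 𝓝 (0 : ℝ), (z t).1 ∈ (extChartAt (𝓡 m) u.proj).target ∧
      pnt u ((z t).1, S (z t).1) ∈ P ∧ DifferentiableAt ℝ S (z t).1 := by
    have h1 : ∀ᶠ y in 𝓝 (crd u u).1, DifferentiableAt ℝ S y := by
      filter_upwards [(hS.of_le (m := 1) (by exact_mod_cast le_top)).eventually (by simp)] with y hy
      exact hy.differentiableAt (by simp)
    have h2 : Tendsto (fun t => (z t).1) (𝓝 0) (𝓝 (crd u u).1) := by
      have := hzc.fst.tendsto
      rwa [hz0] at this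
    filter_upwards [h2.eventually hSP, h2.eventually h1] with t ht ht'
    exact ⟨ht.1, ht.2, ht'⟩
  -- One interval on which the solution exists and its base point stays where S is a section of P;
  -- its connectedness keeps a in the identity component.
  obtain ⟨δ, hδ, hball⟩ := Metric.eventually_nhds_iff_ball.1
    (hgood.and (Ioo_mem_nhds (neg_lt_zero.2 hε) hε))
  rw [Real.ball_eq_Ioo, zero_sub, zero_add] at hball
  have hSOe : ∀ t ∈ Set.Ioo (-δ) δ, ∃ a ∈ SOe m p, (a : gl m) = (z t).2 := fun t ht =>
    exists_mem_SOe_of_hasDerivAt (γ := fun t => (z t).2)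
      (A := fun t => α (z t).1 - pr (α (z t).1)) isPreconnected_Ioo isOpen_Ioo
      (fun t ht => (hz t (hball t ht).2).snd) (fun t _ => (hpr _).2) ⟨neg_lt_zero.2 hδ, hδ⟩
      (by rw [hz0]) ht
  let c : ℝ → HomTM m M := fun t => pnt u ((z t).1, S (z t).1 * (z t).2)
  have hnhds : ∀ t ∈ Set.Ioo (-δ) δ, Set.Ioo (-δ) δ ∈ 𝓝 t := fun t ht => isOpen_Ioo.mem_nhds ht
  have h0 := hnhds 0 ⟨neg_lt_zero.2 hδ, hδ⟩
  refine ⟨c, ?_, ?_, ?_⟩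
  · simp only [c, hz0, hS0, mul_one]
    exact pnt_crd huu
  · filter_upwards [h0] with t ht
    obtain ⟨a, ha, hat⟩ := hSOe t ht
    obtain ⟨⟨h1, h2, -⟩, -⟩ := hball t ht
    simp only [c]
    rw [← rightMul_pnt _ _ h1, ← hat]
    exact hP.1.rightMul_mem _ h2 a ha
  · filter_upwards [h0] with t ht
    obtain ⟨a, ha, hat⟩ := hSOe t ht
    obtain ⟨⟨h1, h2, h3⟩, h4⟩ := hball t ht
    have hsrc : ∀ᶠ s in 𝓝 t, c s ∈ crdSource u ∧
        crd u (c s) = ((z s).1, S (z s).1 * (z s).2) := by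
      filter_upwards [hnhds t ht] with s hs
      exact pnt_mem_crdSource_of_fst _ (hball s hs).1.1
    have hz' := hz t h4
    have hd : HasDerivAt (fun s => crd u (c s)) ((F (z t).1).1,
        fderiv ℝ S (z t).1 (F (z t).1).1 * (z t).2
          + S (z t).1 * ((α (z t).1 - pr (α (z t).1)) * (z t).2)) t := by
      refine HasDerivAt.congr_of_eventuallyEq (f := fun s => ((z s).1, S (z s).1 * (z s).2)) ?_
        (hsrc.mono fun s hs => hs.2)
      exact hz'.fst.prodMk ((h3.hasFDerivAt.comp_hasDerivAt t hz'.fst).mul hz'.snd)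
    obtain ⟨v, hv, hdv⟩ := exists_hasVel_of_hasDerivAt_crd (hsrc.mono fun s hs => hs.1) hd
    refine ⟨v, hv, (a⁻¹ : GLm m) * pr (α (z t).1) * (a : gl m), ?_, ?_⟩
    · have := h𝔪.1 a⁻¹ ((SOe m p).inv_mem ha) _ (hpr (α (z t).1)).1
      rwa [inv_inv] at this
    · refine dcrd_injective hsrc.self_of_nhds.1 ?_
      obtain ⟨h5, h6⟩ := pnt_mem_crdSource_of_fst (S (z t).1) h1
      have hct : c t = rightMul (a : gl m) (pnt u ((z t).1, S (z t).1)) := by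
        rw [rightMul_pnt _ _ h1, hat]
      have hunit : IsUnit (S (z t).1) := by
        have := hP.isUnit_crd h2 h5
        rwa [h6] at this
      have e1 : dcrd u (c t) (Ξ (c t)) = ((F (z t).1).1, (F (z t).1).2 * a) := by
        rw [hct]
        exact hΞ.fieldCrd_mul (hP.1.subset_LM h2) h5 a
      rw [e1, ContinuousLinearMap.map_add, hdv, dcrd_fundamental hsrc.self_of_nhds.1, hsrc.self_of_nhds.2]
      refine Prod.ext (add_zero _).symm ?_
      change (F (z t).1).2 * (a : gl m) = fderiv ℝ S (z t).1 (F (z t).1).1 * (z t).2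
          + S (z t).1 * ((α (z t).1 - pr (α (z t).1)) * (z t).2)
          + S (z t).1 * (z t).2 * ((a⁻¹ : GLm m) * pr (α (z t).1) * (a : gl m))
      have e2 : S (z t).1 * α (z t).1 = (F (z t).1).2 - fderiv ℝ S (z t).1 (F (z t).1).1 := by
        simp only [α]
        rw [← mul_assoc, Ring.mul_inverse_cancel _ hunit, one_mul]
      have e3 : S (z t).1 * (a : gl m) * ((a⁻¹ : GLm m) * pr (α (z t).1) * (a : gl m))
          = S (z t).1 * pr (α (z t).1) * a := by
        rw [mul_assoc, mul_assoc, Units.mul_inv_cancel_left, mul_assoc]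
      clear_value α
      rw [← hat, e3, sub_mul, mul_sub, ← mul_assoc, ← mul_assoc, e2, sub_mul]
      abel

/-- The velocities of a curve in the reduction are tangent to the reduction. -/
lemma mem_tangentOf_of_hasVel {c : ℝ → HomTM m M} {t : ℝ} {v : TangentSpace (IHom m) (c t)}
    (hc : ∀ᶠ s in 𝓝 t, c s ∈ P) (h : HasVel c t v) : v ∈ tangentOf P (c t) := by
  have hadd : Tendsto (fun s : ℝ => t + s) (𝓝 0) (𝓝 t) := by
    have : ContinuousAt (fun s : ℝ => t + s) 0 := by fun_prop
    simpa [ContinuousAt] using this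
  have hsrc := mem_crdSource_self (c t)
  have hct : ContinuousAt c t := HasMFDerivAt.continuousAt h
  refine ⟨fun s => c (t + s), hadd.eventually hc, hasVelocityAt_of_crd (u₀ := c t) ?_ ?_ ?_⟩
  · rw [add_zero]
  · exact hadd.eventually (hct.eventually ((isOpen_crdSource _).mem_nhds hsrc))
  · have h1 := HasVel.hasDerivAt_crd h hsrc
    exact HasDerivAt.comp_const_add (f := fun s => crd (c t) (c s)) t 0 (by rwa [add_zero])

/-- By uniqueness of the splitting, the velocity of such a curve is the value of K. Thus an integral
curve of K is obtained without any regularity of K. -/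
lemma IsOrthonormalReduction.isFlowLine_of_curve (hP : IsOrthonormalReduction g U P)
    {𝔪 : Submodule ℝ (gl m)} (h𝔪 : IsReductiveComplement (SOe m p) 𝔪)
    {Ξ K : ∀ u : HomTM m M, TangentSpace (IHom m) u} (hK : IsKosmann P 𝔪 Ξ K) {u : HomTM m M}
    {c : ℝ → HomTM m M} (h0 : c 0 = u) (hc : ∀ᶠ t in 𝓝 0, c t ∈ P)
    (h : ∀ᶠ t in 𝓝 0, ∃ v, HasVel c t v ∧ ∃ B ∈ 𝔪, Ξ (c t) = v + fundamental B (c t)) :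
    IsFlowLine P K u c := by
  refine ⟨h0, hc, ?_⟩
  filter_upwards [h, hc.eventually_nhds] with t ⟨v, hv, B, hB, hΞ⟩ ht
  have hct := ht.self_of_nhds
  obtain ⟨hKt, B', hB', hΞ'⟩ := hK _ hct
  have e := hP.kosmann_unique h𝔪 hct (mem_tangentOf_of_hasVel ht hv) hKt hB hB'
    (hΞ.symm.trans hΞ')
  exact e ▸ hv

/-- The generalized Kosmann vector field exists. -/
lemma IsOrthonormalReduction.exists_isKosmann (hP : IsOrthonormalReduction g U P)
    {𝔪 : Submodule ℝ (gl m)} (h𝔪 : IsReductiveComplement (SOe m p) 𝔪)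
    {Ξ : ∀ u : HomTM m M, TangentSpace (IHom m) u} (hΞ : IsInvariantField Ξ) :
    ∃ K, IsKosmann P 𝔪 Ξ K := by
  have h1 : ∀ u : HomTM m M, ∃ v : TangentSpace (IHom m) u, u ∈ P →
      v ∈ tangentOf P u ∧ ∃ B ∈ 𝔪, Ξ u = v + fundamental B u := fun u => by
    by_cases hu : u ∈ P
    · obtain ⟨c, rfl, hcP, hc⟩ := hP.exists_curve h𝔪 hΞ hu
      obtain ⟨v, hv, hB⟩ := hc.self_of_nhds
      exact ⟨v, fun _ => ⟨mem_tangentOf_of_hasVel hcP hv, hB⟩⟩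
    · exact ⟨0, fun h => absurd h hu⟩
  choose K hK using h1
  exact ⟨K, hK⟩

/-- The generalized Kosmann vector field has a flow in the reduction. -/
lemma IsOrthonormalReduction.exists_isFlowLine (hP : IsOrthonormalReduction g U P)
    {𝔪 : Submodule ℝ (gl m)} (h𝔪 : IsReductiveComplement (SOe m p) 𝔪)
    {Ξ K : ∀ u : HomTM m M, TangentSpace (IHom m) u} (hΞ : IsInvariantField Ξ)
    (hK : IsKosmann P 𝔪 Ξ K) {u : HomTM m M} (hu : u ∈ P) : ∃ c, IsFlowLine P K u c := by
  obtain ⟨c, h0, hcP, hc⟩ := hP.exists_curve h𝔪 hΞ hu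
  exact ⟨c, hP.isFlowLine_of_curve h𝔪 hK h0 hcP hc⟩

lemma IsFlowLine.hasVelocityAt {K : ∀ u : HomTM m M, TangentSpace (IHom m) u} {u : HomTM m M}
    {c : ℝ → HomTM m M} (h : IsFlowLine P K u c) : HasVelocityAt c u (K u) := by
  obtain ⟨rfl, -, h⟩ := h
  exact ⟨rfl, h.self_of_nhds⟩

/-- The reductive Lie derivative of the metric exists and vanishes. -/
theorem IsOrthonormalReduction.isReductiveLieDeriv_components (hP : IsOrthonormalReduction g U P)
    {𝔪 : Submodule ℝ (gl m)} (h𝔪 : IsReductiveComplement (SOe m p) 𝔪)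
    {Ξ : ∀ u : HomTM m M, TangentSpace (IHom m) u} (hΞ : IsInvariantField Ξ) :
    IsReductiveLieDeriv P 𝔪 Ξ g.components 0 := by
  obtain ⟨K, hK⟩ := hP.exists_isKosmann h𝔪 hΞ
  refine ⟨⟨K, hK, fun u hu => hP.exists_isFlowLine h𝔪 hΞ hK hu⟩, fun K _ u hu c hc a => ?_⟩
  -- Along a flow line in P the components in the frame multiplied by a are the constants η(a eᵢ, a
  -- eⱼ).
  refine (hasDerivAt_const (0 : ℝ) (fun i j : Fin m =>
    eta m p ((a : gl m) (EuclideanSpace.single i 1))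
      ((a : gl m) (EuclideanSpace.single j 1)))).congr_of_eventuallyEq ?_
  filter_upwards [hc.2.1] with t ht
  funext i j
  exact hP.pairing_eq ht _ _

end Reductions

/-! ### The metric lift -/

section MetricLift

variable {m p : ℕ} {M : Type*} [TopologicalSpace M] [ChartedSpace (Rm m) M]
  [IsManifold (𝓡 m) ∞ M] {g : SignatureMetric m M p} {U : Set M} {P : Set (HomTM m M)}

lemma exists_inverse_of_mem_LM {u : HomTM m M} (hu : u ∈ LM m M) :
    ∃ ι : TangentSpace (𝓡 m) u.proj →L[ℝ] Rm m,
      (∀ x, ι (HomTM.hom u x) = x) ∧ ∀ v, HomTM.hom u (ι v) = v := by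
  obtain ⟨a, ha⟩ := (mem_LM_iff (mem_crdSource_self u)).1 hu
  let L := (trivializationAt (Rm m) (TangentSpace (𝓡 m)) u.proj).continuousLinearMapAt ℝ u.proj
  have h1 : ∀ x, ((a⁻¹ : GLm m) : gl m) (L (HomTM.hom u x)) = x := fun x => by
    have h2 : L (HomTM.hom u x) = (a : gl m) x := by
      rw [ha, crd_apply]
      rfl
    rw [h2]
    exact congrArg (fun f : gl m => f x) a.inv_mul
  refine ⟨((a⁻¹ : GLm m) : gl m).comp L, h1, fun v => ?_⟩
  obtain ⟨x, rfl⟩ := hu.2 v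
  exact congrArg (HomTM.hom u) (h1 x)

/-- The metric in a frame, as an endomorphism of `ℝ^m`. -/
noncomputable def gram (g : SignatureMetric m M p) (w : HomTM m M) : gl m :=
  etaJ m p * ∑ i : Fin m, ∑ j : Fin m,
    pairing g (EuclideanSpace.single j 1) (EuclideanSpace.single i 1) w •
      (EuclideanSpace.proj j : Rm m →L[ℝ] ℝ).smulRight (EuclideanSpace.single i (1 : ℝ))

/-- J² = 1 cancels the factor J in `gram`, leaving the Euclidean expansion of the components. It
turns the isometry condition on dφ_t ∘ b_t into β H β = 1. -/
lemma eta_gram (g : SignatureMetric m M p) (w : HomTM m M) (x y : Rm m) :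
    eta m p (gram g w x) y = pairing g x y w := by
  have hJ : ∀ x : Rm m, etaJ m p (etaJ m p x) = x := fun x =>
    congrArg (fun f : gl m => f x) etaJ_mul_self
  have hx : ∀ x : Rm m, x = ∑ i : Fin m, x i • EuclideanSpace.single i (1 : ℝ) := fun x => by
    ext k
    simp [Pi.single_apply]
  rw [eta_eq_inner]
  have e1 : etaJ m p (gram g w x) = ∑ i : Fin m, ∑ j : Fin m,
      (pairing g (EuclideanSpace.single j 1) (EuclideanSpace.single i 1) w * x j) •
        EuclideanSpace.single i (1 : ℝ) := by
    change etaJ m p (etaJ m p _) = _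
    rw [hJ]
    have hsum : ∀ f : Fin m → gl m, (∑ i, f i) x = ∑ i, f i x := fun f =>
      map_sum (ContinuousLinearMap.apply ℝ (Rm m) x) f Finset.univ
    refine (hsum _).trans (Finset.sum_congr rfl fun i _ =>
      (hsum _).trans (Finset.sum_congr rfl fun j _ => ?_))
    change pairing g (EuclideanSpace.single j 1) (EuclideanSpace.single i 1) w •
      (x j • EuclideanSpace.single i (1 : ℝ)) = _
    rw [smul_smul]
  have e2 : pairing g x y w = ∑ i : Fin m, ∑ j : Fin m,
      pairing g (EuclideanSpace.single j 1) (EuclideanSpace.single i 1) w * x j * y i := by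
    have h1 : ∀ (c : Fin m → ℝ) (z : Fin m → Rm m) (y : Rm m),
        pairing g (∑ j, c j • z j) y w = ∑ j, c j * pairing g (z j) y w := fun c z y => by
      simp only [pairing, map_sum, map_smul, sum_apply, smul_apply, smul_eq_mul]
    have h2 : ∀ (c : Fin m → ℝ) (z : Fin m → Rm m) (x : Rm m),
        pairing g x (∑ j, c j • z j) w = ∑ j, c j * pairing g x (z j) w := fun c z x => by
      simp only [pairing, map_sum, map_smul, smul_eq_mul]
    conv_lhs => rw [hx y, h2]
    refine Finset.sum_congr rfl fun i _ => ?_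
    conv_lhs => rw [hx x, h1, Finset.mul_sum]
    exact Finset.sum_congr rfl fun j _ => by ring
  rw [e1, e2, sum_inner]
  refine Finset.sum_congr rfl fun i _ => ?_
  rw [sum_inner]
  refine Finset.sum_congr rfl fun j _ => ?_
  rw [real_inner_smul_left, EuclideanSpace.inner_single_left]
  simp

lemma exists_hasDerivAt_gram (g : SignatureMetric m M p) {c : ℝ → HomTM m M} {u : HomTM m M}
    {v : TangentSpace (IHom m) u} (h : HasVelocityAt c u v) :
    ∃ H', HasDerivAt (fun t => gram g (c t)) H' 0 := by
  refine ⟨_, HasDerivAt.const_mul _ (HasDerivAt.fun_sum fun i _ => HasDerivAt.fun_sum fun j _ =>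
    (h.hasDerivAt_comp (mdifferentiableAt_pairing g _ _ u)).smul_const _)⟩

/-- The metric lift of a flow is its natural lift, up to a differentiable symmetric correction. -/
lemma IsOrthonormalReduction.exists_metricLift_eq (hP : IsOrthonormalReduction g U P)
    {φ : ℝ → M → M} {u : HomTM m M} (hu : u ∈ P) {v : TangentSpace (IHom m) u}
    (hv : HasVelocityAt (fun t => liftMap (φ t) u) u v)
    {b : ℝ → (TangentSpace (𝓡 m) u.proj →L[ℝ] TangentSpace (𝓡 m) u.proj)}
    (hb : IsMetricCorrection g φ u.proj b) :
    ∃ β : ℝ → gl m, ∃ β' ∈ etaSymm m p, β 0 = 1 ∧ HasDerivAt β β' 0 ∧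
      (∀ t, metricLift φ u b t = rightMul (β t) (liftMap (φ t) u)) ∧
      ∀ᶠ t in 𝓝 0, ∀ x y, pairing g x y (metricLift φ u b t) = eta m p x y := by
  obtain ⟨ι, hι, hι'⟩ := exists_inverse_of_mem_LM (hP.1.subset_LM hu)
  obtain ⟨hb0, hbc, hb⟩ := hb
  have hgu : ∀ x y, g.val u.proj (HomTM.hom u x) (HomTM.hom u y) = eta m p x y := hP.2 u hu
  -- The correction b_t read in the frame u, so that it acts on the right of the natural lift.
  let β : ℝ → gl m := fun t => ι.comp ((b t).comp (HomTM.hom u))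
  have huβ : ∀ t x, HomTM.hom u (β t x) = b t (HomTM.hom u x) := fun t x => hι' _
  have hβ0 : β 0 = 1 := by
    refine ContinuousLinearMap.ext fun x => ?_
    simp only [β, hb0]
    exact hι x
  have hβc : ContinuousAt β 0 := by
    have h1 : ∀ i h : gl m, Continuous (fun B : gl m => i.comp (B.comp h)) := fun i h => by
      fun_prop
    exact ContinuousAt.comp (f := b) (h1 ι (HomTM.hom u)).continuousAt hbc
  have hlift : ∀ t, metricLift φ u b t = rightMul (β t) (liftMap (φ t) u) := fun t => by
    refine congrArg (HomTM.mk (φ t u.proj)) (ContinuousLinearMap.ext fun x => ?_)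
    exact (congrArg (mfderiv (𝓡 m) (𝓡 m) (φ t) u.proj) (huβ t x)).symm
  have hiso : ∀ᶠ t in 𝓝 0, ∀ x y, pairing g x y (metricLift φ u b t) = eta m p x y := by
    filter_upwards [hb] with t ht x y
    rw [← hgu]
    exact (ht _ _).2
  have hsymm : ∀ᶠ t in 𝓝 0, ∀ x y, eta m p (β t x) y = eta m p x (β t y) := by
    filter_upwards [hb] with t ht x y
    rw [← hgu, ← hgu, huβ, huβ]
    exact (ht _ _).1
  obtain ⟨H', hH⟩ := exists_hasDerivAt_gram g hv
  have hβ := hasDerivAt_of_mul_mul_eq_one hβc hβ0 hH (by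
    filter_upwards [hiso, hsymm] with t h1 h2
    refine ContinuousLinearMap.ext fun x => eta_ext_right (p := p) fun y => ?_
    change eta m p (β t (gram g (liftMap (φ t) u) (β t x))) y = eta m p x y
    rw [h2, eta_gram, ← pairing_rightMul, ← hlift, h1])
  refine ⟨β, _, fun x y => ?_, hβ0, hβ, hlift, hiso⟩
  -- The derivative β' is symmetric: differentiate η(βx, y) = η(x, βy) at 0.
  have h1 := hasDerivAt_eta (p := p) (hβ.gl_apply x) (hasDerivAt_const 0 y)
  have h2 := hasDerivAt_eta (p := p) (hasDerivAt_const 0 x) (hβ.gl_apply y)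
  have h3 := h1.unique (h2.congr_of_eventuallyEq (hsymm.mono fun t ht => ht x y))
  simpa [eta_eq_inner] using h3

/-- The metric lift of the flow of `ξ` runs in the reduction, and its velocity is the Kosmann vector
field of the natural lift of `ξ`. -/
theorem IsOrthonormalReduction.hasVelocityAt_metricLift (hP : IsOrthonormalReduction g U P)
    {ξ : ∀ x : M, TangentSpace (𝓡 m) x} {Ξ K : ∀ u : HomTM m M, TangentSpace (IHom m) u}
    (hξ : IsNaturalLift ξ Ξ) (hK : IsKosmann P (etaSymm m p) Ξ K) {u : HomTM m M} (hu : u ∈ P)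
    {φ : ℝ → M → M} (hφ : IsLocalFlow ξ u.proj φ)
    {b : ℝ → (TangentSpace (𝓡 m) u.proj →L[ℝ] TangentSpace (𝓡 m) u.proj)}
    (hb : IsMetricCorrection g φ u.proj b) :
    (∀ᶠ t in 𝓝 (0 : ℝ), metricLift φ u b t ∈ P) ∧
      HasVelocityAt (metricLift φ u b) u (K u) := by
  have hv := hξ u (hP.1.subset_LM hu) φ hφ
  obtain ⟨β, β', hβ', hβ0, hβ, hlift, hiso⟩ := hP.exists_metricLift_eq hu hv hb
  have huu := mem_crdSource_self u
  have h0 : metricLift φ u b 0 = u := by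
    rw [hlift, hβ0, rightMul_one]
    exact hv.1
  have hvel : HasVelocityAt (metricLift φ u b) u (Ξ u + fundamental β' u) := by
    refine hasVelocityAt_of_crd (u₀ := u) h0 ?_ ?_
    · filter_upwards [hv.tendsto.eventually ((isOpen_crdSource u).mem_nhds huu)] with t ht
      rw [hlift]
      exact rightMul_mem_crdSource.2 ht
    · have e : (fun t => crd u (metricLift φ u b t)) = fun t =>
          ((crd u (liftMap (φ t) u)).1, (crd u (liftMap (φ t) u)).2 * β t) :=
        funext fun t => by rw [hlift, crd_rightMul]
      have h1 := hv.hasDerivAt_crd huu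
      have h4 : HasDerivAt (fun t => (crd u (liftMap (φ t) u)).2) (dcrd u u (Ξ u)).2 0 := h1.snd
      have h2 := h1.fst.prodMk (h4.mul hβ)
      rw [e, ContinuousLinearMap.map_add, dcrd_fundamental huu]
      have h3 : liftMap (φ 0) u = u := hv.1
      rw [hβ0, h3, mul_one] at h2
      have e2 : dcrd u u (Ξ u) + (0, (crd u u).2 * β')
          = ((dcrd u u (Ξ u)).1, (dcrd u u (Ξ u)).2 + (crd u u).2 * β') :=
        Prod.ext (add_zero _) rfl
      rw [e2]
      exact h2
  have hmem : ∀ᶠ t in 𝓝 (0 : ℝ), metricLift φ u b t ∈ P := by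
    filter_upwards [hvel.tendsto.eventually (hP.eventually_mem hu), hiso] with t ht ht'
    exact ht ht'
  refine ⟨hmem, ?_⟩
  obtain ⟨hKu, B, hB, hΞ⟩ := hK u hu
  -- Ξ = (Ξ + fundamental β') + fundamental (-β') is a splitting of the Kosmann type, hence the only
  -- one.
  have e := hP.kosmann_unique (isReductiveComplement_etaSymm m p) hu ⟨_, hmem, hvel⟩ hKu
    ((etaSymm m p).neg_mem hβ') hB (by
      rw [fundamental_neg, add_neg_cancel_right]
      exact hΞ)
  exact e ▸ hvel

end MetricLift

/-! ### Comparison of the Lie derivatives -/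

section Comparison

variable {m p : ℕ} {M : Type*} [TopologicalSpace M] [ChartedSpace (Rm m) M]
  [IsManifold (𝓡 m) ∞ M] {g : SignatureMetric m M p} {U : Set M} {P : Set (HomTM m M)}

/-- The generalized Kosmann vector field is invariant under the structure group of the reduction. -/
lemma IsOrthonormalReduction.kosmann_rightMul (hP : IsOrthonormalReduction g U P)
    {𝔪 : Submodule ℝ (gl m)} (h𝔪 : IsReductiveComplement (SOe m p) 𝔪)
    {Ξ K : ∀ u : HomTM m M, TangentSpace (IHom m) u} (hΞ : IsInvariantField Ξ)
    (hK : IsKosmann P 𝔪 Ξ K) {u : HomTM m M} (hu : u ∈ P) {c : ℝ → HomTM m M}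
    (hc : IsFlowLine P K u c) {a : GLm m} (ha : a ∈ SOe m p) :
    HasVelocityAt (fun t => rightMul (a : gl m) (c t)) (rightMul (a : gl m) u)
      (K (rightMul (a : gl m) u)) := by
  obtain ⟨hKu, B, hB, hΞu⟩ := hK u hu
  have hau := hP.1.rightMul_mem u hu a ha
  obtain ⟨hKau, B', hB', hΞau⟩ := hK _ hau
  have huu := mem_crdSource_self u
  have hvel : HasVelocityAt (fun t => rightMul (a : gl m) (c t)) (rightMul (a : gl m) u)
      (mfderiv (IHom m) (IHom m) (rightMul (a : gl m)) u (K u)) := by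
    obtain ⟨rfl, h⟩ := hc.hasVelocityAt
    exact ⟨rfl, HasVel.comp_rightMul h _⟩
  have hmem : ∀ᶠ t in 𝓝 (0 : ℝ), rightMul (a : gl m) (c t) ∈ P :=
    hc.2.1.mono fun t ht => hP.1.rightMul_mem _ ht a ha
  -- Right multiplication by a carries the fundamental vector of B at u to that of a⁻¹ B a at u · a.
  have hB2 : ((a⁻¹ : GLm m) : gl m) * B * (a : gl m) ∈ 𝔪 := by
    have := h𝔪.1 a⁻¹ ((SOe m p).inv_mem ha) _ hB
    rwa [inv_inv] at this
  have e := hP.kosmann_unique h𝔪 hau ⟨_, hmem, hvel⟩ hKau hB2 hB' (by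
    rw [← hΞau]
    refine dcrd_injective (u₀ := u) (rightMul_mem_crdSource.2 huu) ?_
    rw [hΞ.fieldCrd_mul (hP.1.subset_LM hu) huu, hΞu, ContinuousLinearMap.map_add,
      ContinuousLinearMap.map_add, dcrd_mfderiv_rightMul huu, dcrd_fundamental huu,
      dcrd_fundamental (rightMul_mem_crdSource.2 huu), crd_rightMul]
    refine Prod.ext rfl ?_
    change (dcrd u u (K u)).2 * (a : gl m) + (crd u u).2 * (a : gl m) * _
      = ((dcrd u u (K u)).2 + (crd u u).2 * B) * (a : gl m)
    rw [add_mul, mul_assoc, mul_assoc, Units.mul_inv_cancel_left, mul_assoc])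
  exact e ▸ hvel

lemma rightMul_inv_rightMul (a : GLm m) (w : HomTM m M) :
    rightMul (a : gl m) (rightMul ((a⁻¹ : GLm m) : gl m) w) = w := by
  rw [rightMul_rightMul, Units.inv_mul, rightMul_one]

/-- On sections of associated bundles, the reductive Lie derivative along a natural lift is the
metric Lie derivative. -/
theorem IsOrthonormalReduction.exists_lieDeriv (hP : IsOrthonormalReduction g U P)
    {ξ : ∀ x : M, TangentSpace (𝓡 m) x} {Ξ : ∀ u : HomTM m M, TangentSpace (IHom m) u}
    (hΞ : IsInvariantField Ξ) (hξ : IsNaturalLift ξ Ξ)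
    {V : Type*} [NormedAddCommGroup V] [NormedSpace ℝ V]
    (ρ : GLm m →* (V →L[ℝ] V)) {f : HomTM m M → V}
    (hf : ContMDiffOn (IHom m) 𝓘(ℝ, V) ∞ f (LM m M))
    (hρ : ∀ u ∈ LM m M, ∀ a : GLm m, f (rightMul (a : gl m) u) = ρ a⁻¹ (f u)) :
    ∃ D : HomTM m M → V, IsReductiveLieDeriv P (etaSymm m p) Ξ f D ∧
      IsMetricLieDeriv g U ξ f D := by
  classical
  have h𝔪 := isReductiveComplement_etaSymm m p
  obtain ⟨K, hK⟩ := hP.exists_isKosmann h𝔪 hΞ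
  have hdf : ∀ u ∈ P, MDifferentiableAt (IHom m) 𝓘(ℝ, V) f u := fun u hu =>
    (hf.contMDiffAt (isOpen_LM.mem_nhds (hP.1.subset_LM hu))).mdifferentiableAt (by simp)
  -- The derivative of f along the Kosmann vector; it serves every curve in P with that velocity,
  -- flow line or metric lift.
  let E : HomTM m M → V := fun u => mfderiv (IHom m) 𝓘(ℝ, V) f u (K u)
  have hE : ∀ u ∈ P, ∀ c : ℝ → HomTM m M, (∀ᶠ t in 𝓝 0, c t ∈ P) → HasVelocityAt c u (K u) →
      ∀ a : GLm m, HasDerivAt (fun t => f (rightMul (a : gl m) (c t))) (ρ a⁻¹ (E u)) 0 := by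
    intro u hu c hc hcv a
    have h1 := hcv.hasDerivAt_comp (hdf u hu)
    refine ((ρ a⁻¹).hasFDerivAt.comp_hasDerivAt 0 h1).congr_of_eventuallyEq ?_
    filter_upwards [hc] with t ht
    exact hρ _ (hP.1.subset_LM ht) a
  have hEinv : ∀ u ∈ P, ∀ a ∈ SOe m p, E (rightMul (a : gl m) u) = ρ a⁻¹ (E u) := by
    intro u hu a ha
    obtain ⟨c, hc⟩ := hP.exists_isFlowLine h𝔪 hΞ hK hu
    have h1 := hE u hu c hc.2.1 hc.hasVelocityAt a
    exact ((hP.kosmann_rightMul h𝔪 hΞ hK hu hc ha).hasDerivAt_comp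
      (hdf _ (hP.1.rightMul_mem u hu a ha))).unique h1
  -- The equivariant extension of E from P to all frames u · a. The chosen a is ambiguous up to
  -- SO(p,q)^e, which `hEinv` absorbs; frames off these orbits get the value 0.
  let D : HomTM m M → V := fun w =>
    if h : ∃ a : GLm m, rightMul ((a⁻¹ : GLm m) : gl m) w ∈ P then
      ρ h.choose⁻¹ (E (rightMul ((h.choose⁻¹ : GLm m) : gl m) w)) else 0
  have hD : ∀ u ∈ P, ∀ a : GLm m, D (rightMul (a : gl m) u) = ρ a⁻¹ (E u) := by
    intro u hu a
    have h : ∃ a' : GLm m, rightMul ((a'⁻¹ : GLm m) : gl m) (rightMul (a : gl m) u) ∈ P := by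
      refine ⟨a, ?_⟩
      rwa [rightMul_rightMul, Units.mul_inv, rightMul_one]
    have hDw : D (rightMul (a : gl m) u) = ρ h.choose⁻¹
      (E (rightMul ((h.choose⁻¹ : GLm m) : gl m) (rightMul (a : gl m) u))) := dif_pos h
    rw [hDw]
    have hu' := h.choose_spec
    set a' := h.choose
    obtain ⟨s, hs, hsu⟩ := hP.1.transitive u hu _ hu' rfl
    rw [hsu, hEinv u hu s hs, ← mul_apply_eq_comp, ← map_mul, ← mul_inv_rev]
    have hinj : rightMul ((s * a' : GLm m) : gl m) u = rightMul (a : gl m) u := by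
      rw [Units.val_mul, ← rightMul_rightMul, ← hsu, rightMul_inv_rightMul]
    -- The right action on frames is free.
    have hsa : s * a' = a := by
      have h1 := congrArg (fun w => (crd u w).2) hinj
      simp only [crd_rightMul] at h1
      exact Units.ext ((hP.isUnit_crd hu (mem_crdSource_self u)).mul_left_cancel h1)
    rw [hsa]
  refine ⟨D, ⟨⟨K, hK, fun u hu => hP.exists_isFlowLine h𝔪 hΞ hK hu⟩, ?_⟩, ?_⟩
  · intro K' hK' u hu c hc a
    have hKK : K' u = K u := by
      obtain ⟨h1, B, hB, h2⟩ := hK' u hu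
      obtain ⟨h3, B', hB', h4⟩ := hK u hu
      exact hP.kosmann_unique h𝔪 hu h1 h3 hB hB' (h2.symm.trans h4)
    rw [hD u hu a]
    exact hE u hu c hc.2.1 (hKK ▸ hc.hasVelocityAt) a
  · intro w hw hwU φ hφ b hb
    obtain ⟨N, -, hxN, s, -, hsN⟩ := hP.1.local_section w.proj hwU
    obtain ⟨hsP, hsx⟩ := hsN _ hxN
    obtain ⟨a, ha⟩ := exists_rightMul_eq (hP.1.subset_LM hsP) hw hsx.symm
    have hu : rightMul ((a⁻¹ : GLm m) : gl m) w ∈ P := by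
      rwa [ha, rightMul_rightMul, Units.mul_inv, rightMul_one]
    obtain ⟨h1, h2⟩ := hP.hasVelocityAt_metricLift (u := rightMul ((a⁻¹ : GLm m) : gl m) w)
      hξ hK hu hφ hb
    have h3 := hE _ hu _ h1 h2 a
    rw [← hD _ hu a, rightMul_inv_rightMul] at h3
    -- The correction b_t acts on the tangent space, on the left of the frame, so metric lifting
    -- commutes with the right action.
    have h4 : ∀ t, rightMul (a : gl m) (metricLift φ (rightMul ((a⁻¹ : GLm m) : gl m) w) b t)
        = metricLift φ w b t := fun t => by
      refine congrArg (HomTM.mk (φ t w.proj)) (ContinuousLinearMap.ext fun x => ?_)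
      have h5 : ((a⁻¹ : GLm m) : gl m) ((a : gl m) x) = x :=
        congrArg (fun f : gl m => f x) a.inv_mul
      exact congrArg (fun x => mfderiv (𝓡 m) (𝓡 m) (φ t) w.proj (b t (HomTM.hom w x))) h5
    simp only [h4] at h3
    exact h3

end Comparison

end Library

theorem mainTheorem6 (m p q : ℕ) (hpq : p + q = m)
    {M : Type*} [TopologicalSpace M] [T2Space M] [ChartedSpace (Rm m) M] [IsManifold (𝓡 m) ∞ M]
    (g : SignatureMetric m M p)
    (U : Set M) (hU : IsOpen U)
    (P : Set (HomTM m M)) (hP : IsOrthonormalReduction g U P)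
    (Ξ : ∀ u : HomTM m M, TangentSpace (IHom m) u) (hΞ : IsInvariantField Ξ) :
    IsReductiveComplement (SOe m p) (etaSymm m p) ∧
    (∀ 𝔪 : Submodule ℝ (gl m), IsReductiveComplement (SOe m p) 𝔪 →
      IsReductiveLieDeriv P 𝔪 Ξ g.components 0) ∧
    (∀ ξ : ∀ x : M, TangentSpace (𝓡 m) x,
      ContMDiff (𝓡 m) (𝓡 m).tangent ∞ (fun x => (⟨x, ξ x⟩ : TangentBundle (𝓡 m) M)) →
      IsNaturalLift ξ Ξ →
      (∀ K, IsKosmann P (etaSymm m p) Ξ K → ∀ u ∈ P, ∀ φ, IsLocalFlow ξ u.proj φ →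
        ∀ b, IsMetricCorrection g φ u.proj b →
          (∀ᶠ t in 𝓝 (0 : ℝ), metricLift φ u b t ∈ P) ∧
            HasVelocityAt (metricLift φ u b) u (K u)) ∧
      (∀ (V : Type*) [NormedAddCommGroup V] [NormedSpace ℝ V] [FiniteDimensional ℝ V]
        (ρ : GLm m →* (V →L[ℝ] V)) (f : HomTM m M → V),
        ContMDiffOn (IHom m) 𝓘(ℝ, V) ∞ f (LM m M) →
        (∀ u ∈ LM m M, ∀ a : GLm m, f (rightMul (a : gl m) u) = ρ a⁻¹ (f u)) →
        ∃ D : HomTM m M → V, IsReductiveLieDeriv P (etaSymm m p) Ξ f D ∧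
          IsMetricLieDeriv g U ξ f D)) := by
  refine ⟨isReductiveComplement_etaSymm m p, fun 𝔪 h𝔪 => hP.isReductiveLieDeriv_components h𝔪 hΞ,
    fun ξ _ hξ => ⟨fun K hK u hu φ hφ b hb => hP.hasVelocityAt_metricLift hξ hK hu hφ hb, ?_⟩⟩
  intro V _ _ _ ρ f hf hρ
  exact hP.exists_lieDeriv hΞ hξ ρ hf hρ
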